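/- Let $\mathbb F$ be a field of characteristic zero, $\rho^2:=y^2+z^2$, $E:=x\partial_x+\tfrac12y\partial_y+\tfrac12z\partial_z$, $\Theta^0_0:=z\partial_y-y\partial_z$, and $E^l_k:=x^l\rho^{2(k-l)}E$, $Z^l_k:=x^l\rho^{2(k-l)}$ for $0\le l\le k$; both have grade $2k-l$. Let $\mathscr R$ be the space of all $T(x,\rho^2)$ with $T$ a formal power series over $\mathbb F$ in two variables without constant term, $\mathscr E:=\mathscr R\,E$ (the formal sums of the $E^l_k$ with $l+k\ge1$), and let $\mathscr E_n$, $\mathscr R_n$ be the subspaces of grade $n$. Permissible changes of state variables are the elements of the group generated by the formal flows $\exp(S)$, $S\in\mathscr E$. Permissible orbital transformations are the pairs $(\tau,\varphi)$ in the group generated by these and by the time rescalings, i.e. the multiplications by series $\tau(x,\rho^2)$ with $\tau(0,0)\ne0$. They act on $\Theta^0_0+\mathscr E$ as follows: $\Theta^0_0$ (which commutes with $\mathscr E$) is removed by passing to the rotating frame, the remaining $u\in\mathscr E$ is sent to $\tau\cdot\varphi_*u$, and $\Theta^0_0$ is put back. Infinitesimally, $(S,T)*u=[S,u]+Tu$ for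 $(S,T)\in\mathscr E\times\mathscr R$. The symmetry group of $v\in\Theta^0_0+\mathscr E$ is the group of permissible orbital transformations leaving $v$ invariant; its space of generators is $\{(S,T)\in\mathscr E\times\mathscr R: (S,T)*(v-\Theta^0_0)=0\}$. A normal form style is a rule choosing, for each $n$ and each subspace of $\mathscr E_n$, a complement of it in $\mathscr E_n$. An element $v=\Theta^0_0+\sum_{i\ge1}v_i$ with $v_i\in\mathscr E_i$ is a simplest (infinite level) orbital normal form with respect to the style if, for all $n\ge1$, $v_n$ lies in the chosen complement of the space of all $\sum_{i=1}^{n-1}Y_{n-i}*v_i$, where $Y_j\in\mathscr E_j\times\mathscr R_j$ and $\sum_{i=1}^{m-1}Y_{m-i}*v_i=0$ for all $m<n$. Theorem. (1) There is a normal form style such that every $v\in\Theta^0_0+\mathscr E$ with nonzero quadratic part can be transformed by a permissible orbital transformation into $$v^{(\infty)}=\Theta^0_0+E^1_1+\beta^0_1E^0_1+\beta^0_rE^0_r$$ for some $r\ge2$ and $\beta^0_1,\beta^0_r\in\mathbb F$, and this $v^{(\infty)}$ is a simplest orbital normal form with respect to the style. The vector field $v^{(\infty)}$ is the only one of this shape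 into which $v$ can be transformed. (2) For all $r\ge2$ and $\beta^0_1,\beta^0_r\in\mathbb F$, the symmetry group of $v^{(\infty)}$ is not finitely generated, and its space of generators is infinite-dimensional over $\mathbb F$. (3) If moreover $\beta^0_r\ne0$, the symmetry group contains no non-trivial symmetry from changes of state variables alone: a permissible change of state variables $\varphi$ is a symmetry of $v^{(\infty)}$ if and only if it is trivial, i.e. belongs to the flow of the vector field itself, $\varphi=\exp\bigl(t\,(v^{(\infty)}-\Theta^0_0)\bigr)$ for some $t\in\mathbb F$. -/

import Mathlib

namespace HopfZero

noncomputable section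

/-- Formal power series in the three state variables `x = X 0`, `y = X 1`, `z = X 2`. -/
abbrev PS (F : Type*) [Field F] := MvPowerSeries (Fin 3) F

/-- Formal vector fields on three-space, as derivations of the ring of formal power series.
The Lie bracket of Mathlib is the usual one, `⁅v, w⁆ g = v (w g) - w (v g)`. -/
abbrev VF (F : Type*) [Field F] := Derivation F (PS F) (PS F)

/-- `y ^ 2 + z ^ 2`. -/
def rhoSq (F : Type*) [Field F] : PS F := MvPowerSeries.X 1 ^ 2 + MvPowerSeries.X 2 ^ 2

theorem hasSubst_planar (F : Type*) [Field F] :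
    MvPowerSeries.HasSubst (![MvPowerSeries.X 0, rhoSq F] : Fin 2 → PS F) := by
  apply MvPowerSeries.hasSubst_of_constantCoeff_zero
  intro i
  fin_cases i <;> simp [rhoSq]

/-- The substitution `f ↦ f (x, y ^ 2 + z ^ 2)`. -/
def planar (F : Type*) [Field F] : MvPowerSeries (Fin 2) F →ₐ[F] PS F :=
  MvPowerSeries.substAlgHom (hasSubst_planar F)

/-- `E = x ∂x + (1/2) y ∂y + (1/2) z ∂z`. -/
def euler (F : Type*) [Field F] : VF F :=
  (MvPowerSeries.X 0 : PS F) • MvPowerSeries.pderiv F 0 +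
    (2⁻¹ : F) • ((MvPowerSeries.X 1 : PS F) • MvPowerSeries.pderiv F 1) +
    (2⁻¹ : F) • ((MvPowerSeries.X 2 : PS F) • MvPowerSeries.pderiv F 2)

/-- `Θ⁰₀ = z ∂y - y ∂z`. -/
def rot (F : Type*) [Field F] : VF F :=
  (MvPowerSeries.X 2 : PS F) • MvPowerSeries.pderiv F 1 -
    (MvPowerSeries.X 1 : PS F) • MvPowerSeries.pderiv F 2

/-- `Zˡₖ`, that is `x ^ l * (y ^ 2 + z ^ 2) ^ (k - l)`; used only for `l ≤ k`. -/
def timeMonomial (F : Type*) [Field F] (l k : ℕ) : PS F :=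
  MvPowerSeries.X 0 ^ l * rhoSq F ^ (k - l)

/-- `Eˡₖ`, that is `x ^ l * (y ^ 2 + z ^ 2) ^ (k - l) * E`; used only for `l ≤ k`. -/
def eulerMonomial (F : Type*) [Field F] (l k : ℕ) : VF F :=
  timeMonomial F l k • euler F

/-- The space of time rescaling generators: all `T (x, y ^ 2 + z ^ 2)`, where `T` is a formal
power series in two variables without constant term. -/
def timeSpace (F : Type*) [Field F] : Submodule F (PS F) :=
  Submodule.map (planar F).toLinearMap
    (LinearMap.ker (MvPowerSeries.coeff (R := F) (0 : Fin 2 →₀ ℕ)))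

/-- Multiplication of the Euler field by a scalar series. -/
def mulEuler (F : Type*) [Field F] : PS F →ₗ[F] VF F :=
  (LinearMap.toSpanSingleton (PS F) (VF F) (euler F)).restrictScalars F

/-- The space `𝓔` of all formal sums of the `Eˡₖ` with `l ≤ k` and `l + k ≥ 1`: all
`f (x, y ^ 2 + z ^ 2) E`, where `f` is a formal power series without constant term. -/
def eulerSpace (F : Type*) [Field F] : Submodule F (VF F) :=
  Submodule.map (mulEuler F) (timeSpace F)

/-- Some component of the vector field has a nonzero coefficient of total degree two. -/
def HasNonzeroQuadraticPart {F : Type*} [Field F] (v : VF F) : Prop :=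
  ∃ (i : Fin 3) (d : Fin 3 →₀ ℕ), d.degree = 2 ∧
    MvPowerSeries.coeff d (v (MvPowerSeries.X i)) ≠ 0

/-- `φ` is the exponential (the time-one map of the formal flow) of the vector field `S`.
It is only used for `S` in `𝓔`. Such an `S` raises the order of every series by at least one,
so that the terms `S ^ n g / n!` with `n` larger than the total degree of `d` do not contribute
to the coefficient of `d`. -/
def IsExp {F : Type*} [Field F] (S : VF F) (φ : PS F ≃ₐ[F] PS F) : Prop :=
  ∀ (g : PS F) (d : Fin 3 →₀ ℕ), MvPowerSeries.coeff d (φ g) =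
    ∑ n ∈ Finset.range (d.degree + 1),
      ((n.factorial : F))⁻¹ * MvPowerSeries.coeff d ((fun h => S h)^[n] g)

/-- The group of permissible changes of the state variables, generated by the exponentials of the
elements of `𝓔`. A formal change of variables is identified with the automorphism
of the ring of formal power series that it induces. -/
def stateGroup (F : Type*) [Field F] : Subgroup (PS F ≃ₐ[F] PS F) :=
  Subgroup.closure {φ | ∃ S ∈ eulerSpace F, IsExp S φ}

/-- The transport of a vector field by a formal change of variables. -/
def transport {F : Type*} [Field F] (φ : PS F ≃ₐ[F] PS F) (v : VF F) : VF F :=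
  Derivation.mk' (φ.toLinearMap ∘ₗ v.toLinearMap ∘ₗ φ.symm.toLinearMap) (by
    intro a b
    simp)

/-- Pairs `(τ, φ)` of a unit `τ` (time rescaling) and a formal change of variables `φ`. The product
is `(τ, φ) * (σ, ψ) = (τ * φ σ, φ * ψ)`. -/
abbrev OrbitalTransformation (F : Type*) [Field F] :=
  (PS F)ˣ ⋊[MulDistribMulAction.toMulAut (PS F ≃ₐ[F] PS F) (PS F)ˣ] (PS F ≃ₐ[F] PS F)

/-- `(τ, φ)` first applies the change of variables `φ` and then multiplies by `τ`. -/
instance orbitalAction (F : Type*) [Field F] : MulAction (OrbitalTransformation F) (VF F) where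
  smul g v := (g.left : PS F) • transport g.right v
  one_smul v := by
    change ((1 : OrbitalTransformation F).left : PS F) •
      transport (1 : OrbitalTransformation F).right v = v
    ext1 a
    simp [transport, AlgEquiv.aut_one]
  mul_smul g h v := by
    change ((g * h).left : PS F) • transport (g * h).right v =
      (g.left : PS F) • transport g.right ((h.left : PS F) • transport h.right v)
    have key : ∀ (φ : PS F ≃ₐ[F] PS F) (w : VF F) (a : PS F),
        transport φ w a = φ (w (φ.symm a)) := fun _ _ _ => rfl
    have hs : (g.right * h.right).symm = g.right.symm.trans h.right.symm := rfl
    ext1 a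
    simp [key, hs, mul_assoc]

/-- The group of permissible orbital transformations: it is generated by the
changes of state variables and by the time rescalings `τ (x, y ^ 2 + z ^ 2)` with `τ (0, 0) ≠ 0`. -/
def permissibleGroup (F : Type*) [Field F] : Subgroup (OrbitalTransformation F) :=
  Subgroup.closure
    ({g | ∃ φ ∈ stateGroup F, g = SemidirectProduct.inr φ} ∪
      {g | ∃ τ : (PS F)ˣ, (τ : PS F) ∈ Set.range (planar F) ∧ g = SemidirectProduct.inl τ})

/-- Orbital equivalence in `Θ⁰₀ + 𝓔`. The linear part `Θ⁰₀`, which commutes with `𝓔`, is removed by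
passing to the rotating frame `exp (t Θ⁰₀)`, a permissible transformation is applied to the
remaining element of `𝓔`, and `Θ⁰₀` is put back by leaving the rotating frame. -/
def OrbitallyEquivalent {F : Type*} [Field F] (v w : VF F) : Prop :=
  ∃ g ∈ permissibleGroup F, w = rot F + g • (v - rot F)

/-- The symmetry group of an element `v` of `Θ⁰₀ + 𝓔`: the permissible transformations, acting as
in `OrbitallyEquivalent`, that leave `v` invariant. -/
def symmetryGroup {F : Type*} [Field F] (v : VF F) : Subgroup (OrbitalTransformation F) :=
  permissibleGroup F ⊓ MulAction.stabilizer (OrbitalTransformation F) (v - rot F)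

/-- The infinitesimal action `(S, T) * v = ⁅S, v⁆ + T v` on a given `v`, as a linear
map in `(S, T)`. -/
def infAction {F : Type*} [Field F] (v : VF F) : (VF F × PS F) →ₗ[F] VF F where
  toFun Y := ⁅Y.1, v⁆ + Y.2 • v
  map_add' Y Z := by
    ext1 a
    simp only [Prod.fst_add, Prod.snd_add, add_smul, Derivation.commutator_apply,
      Derivation.add_apply, map_add]
    abel
  map_smul' c Y := by
    ext1 a
    simp only [Prod.smul_fst, Prod.smul_snd, smul_assoc, Derivation.commutator_apply,
      Derivation.add_apply, Derivation.smul_apply, Derivation.map_smul, smul_add, smul_sub,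
      RingHom.id_apply]

/-- The generators of the symmetry group of `v`: all pairs `(S, T)` of a state generator and a time
generator with `(S, T) * (v - Θ⁰₀) = 0`. -/
def coNormalSpace {F : Type*} [Field F] (v : VF F) : Submodule F (VF F × PS F) :=
  (eulerSpace F).prod (timeSpace F) ⊓ LinearMap.ker (infAction (v - rot F))

/-- `𝓔ₙ`, spanned by the `Eˡₖ` of grade `2 k - l = n`. -/
def eulerGrade (F : Type*) [Field F] (n : ℕ) : Submodule F (VF F) :=
  Submodule.span F {w | ∃ l k : ℕ, l ≤ k ∧ 2 * k = n + l ∧ w = eulerMonomial F l k}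

/-- The span of the `Zˡₖ` of grade `2 k - l = n`. -/
def timeGrade (F : Type*) [Field F] (n : ℕ) : Submodule F (PS F) :=
  Submodule.span F {w | ∃ l k : ℕ, l ≤ k ∧ 2 * k = n + l ∧ w = timeMonomial F l k}

/-- `p n` is the component of grade `n` of `u`, for all `n`. The components of the field `p n`
are homogeneous of total degree `n + 1`, so that the coefficient of `d` in the formal
sum `∑ p n` only involves `n` below the total degree of `d`. -/
def IsGradeDecomposition {F : Type*} [Field F] (u : VF F) (p : ℕ → VF F) : Prop :=
  (∀ n, p n ∈ eulerGrade F n) ∧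
    ∀ (i : Fin 3) (d : Fin 3 →₀ ℕ), MvPowerSeries.coeff d (u (MvPowerSeries.X i)) =
      ∑ n ∈ Finset.range (d.degree + 1), MvPowerSeries.coeff d (p n (MvPowerSeries.X i))

/-- The component of grade `n` of `(∑ Yᵢ) * (∑ pⱼ)`, where `Yᵢ` and `pⱼ` are of grade
`i ≥ 1` and `j ≥ 1`: the sum of the `Y₍ₙ₋ᵢ₎ * pᵢ` with `1 ≤ i < n`. -/
def levelMap {F : Type*} [Field F] (p : ℕ → VF F) (n : ℕ) :
    (ℕ → VF F × PS F) →ₗ[F] VF F :=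
  ∑ i ∈ Finset.Ico 1 n, infAction (p i) ∘ₗ LinearMap.proj (n - i)

/-- The image of the map `d^{n,n}`: the values of `levelMap p n` on the sequences of
generators `Yᵢ ∈ 𝓔ᵢ × 𝓡ᵢ` for which all components of grade `m < n` vanish. -/
def removable {F : Type*} [Field F] (p : ℕ → VF F) (n : ℕ) : Submodule F (VF F) :=
  Submodule.map (levelMap p n)
    (Submodule.pi Set.univ (fun i => (eulerGrade F i).prod (timeGrade F i)) ⊓
      ⨅ m ∈ Finset.range n, LinearMap.ker (levelMap p m))

/-- A normal form style: a rule that chooses a complement in `𝓔ₙ` to each subspace of `𝓔ₙ`. -/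
structure NormalFormStyle (F : Type*) [Field F] where
  /-- the chosen complement -/
  compl : ℕ → Submodule F (VF F) → Submodule F (VF F)
  disjoint_compl : ∀ n W, W ≤ eulerGrade F n → Disjoint W (compl n W)
  sup_compl : ∀ n W, W ≤ eulerGrade F n → W ⊔ compl n W = eulerGrade F n

/-- `v` is in infinite level orbital normal form (is a simplest orbital normal form)
with respect to the style `σ`. -/
def IsInfiniteLevel {F : Type*} [Field F] (σ : NormalFormStyle F) (v : VF F) : Prop :=
  ∃ p : ℕ → VF F, IsGradeDecomposition (v - rot F) p ∧
    ∀ n, 1 ≤ n → p n ∈ σ.compl n (removable p n)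

/-- `Θ⁰₀ + E¹₁ + b E⁰₁ + c E⁰ᵣ`. -/
def orbitalNF {F : Type*} [Field F] (r : ℕ) (b c : F) : VF F :=
  rot F + eulerMonomial F 1 1 + b • eulerMonomial F 0 1 + c • eulerMonomial F 0 r

end

end HopfZero

/-! Put w = y² + z². The rotation-invariant series are the series in x and w (`mem_range_planar`),
so an element of 𝓔 is f E with f invariant and without constant term. Since E x = x and E w = w, a
permissible change of variables multiplies x and w by one common unit H with H(0) = 1
(`IsEquivariantScaling.exists_scale`) and sends E to an invariant unit times E
(`IsEquivariantScaling.transport_euler`). A time rescaling multiplies f by an invariant unit.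
Orbital equivalence of f E is therefore a question about the curve f = 0 in the (x, w)-plane, moved
by the scalings (x, w) ↦ (H x, H w).

Existence: a nonzero quadratic part means that x occurs in f. Weierstrass preparation turns f into x
+ p(w) (`exists_mul_eq_X_add_radial`), where p = b w + c w^r u(w), r ≥ 2 and u(0) = 1. A flow
depending on w only, with H^(r-1) = u, absorbs u (`exists_flow_rhoSq_pow`). Uniqueness: restrict to
the curve of one normal form and compare the coefficients of w and w^r (`nfSeries_unique`). Simplest
form: below grade 2r the normal form contains only x and b w, both of E-weight one, so (g E, T) acts
as multiplication by g - E g + T. Level by level these multipliers vanish, and what remains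
removable at grade 2k ≤ 2r is divisible by x; E⁰ₖ is not (`eulerMonomial_notMem_removable`).

Symmetries: f E is annihilated by (f q E, f (E q)) for every q (`infAction_symmetryGenerator`).
Series q in w alone give an infinite-dimensional space of generators. They also integrate to
uncountably many symmetries (`exists_symmetry`, `eq_of_expOp_eq`), too many for a finitely generated
group. For a symmetry from state variables alone, put η = H - 1. The lowest part of η must have
E-weight one, so η starts with combinations of x and w; if c ≠ 0, restriction to x + b w = 0 ties
these two coefficients together (`SymmetryEquation.coeff_rhoSq_eq`). One parameter is left, and the
flow of f E itself uses it up (`exists_isExp_of_transport`). -/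

namespace HopfZero

noncomputable section

open MvPowerSeries

/-! ### The order filtration on power series; rigidity of derivations and automorphisms. -/

section OrderFiltration

variable {F : Type*} [Field F] {n : ℕ}

/-- The power series with given coefficients. -/
def ofCoeff (c : (Fin n →₀ ℕ) → F) : MvPowerSeries (Fin n) F := c

@[simp]
theorem coeff_ofCoeff (c : (Fin n →₀ ℕ) → F) (d : Fin n →₀ ℕ) : coeff d (ofCoeff c) = c d := rfl

/-- The ideal of the power series without terms of total degree less than `N`. -/
def orderIdeal (F : Type*) [Field F] (n N : ℕ) : Ideal (MvPowerSeries (Fin n) F) where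
  carrier := {q | ∀ d : Fin n →₀ ℕ, d.degree < N → coeff d q = 0}
  add_mem' ha hb d hd := by rw [map_add, ha d hd, hb d hd, add_zero]
  zero_mem' d _ := map_zero _
  smul_mem' c q hq d hd := by
    classical
    rw [smul_eq_mul, coeff_mul]
    refine Finset.sum_eq_zero fun p hp => ?_
    rw [Finset.HasAntidiagonal.mem_antidiagonal] at hp
    rw [hq p.2, mul_zero]
    have := congrArg Finsupp.degree hp
    rw [map_add] at this
    omega

theorem mem_orderIdeal {N : ℕ} {q : MvPowerSeries (Fin n) F} :
    q ∈ orderIdeal F n N ↔ ∀ d : Fin n →₀ ℕ, d.degree < N → coeff d q = 0 := Iff.rfl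

theorem mem_orderIdeal_iff_le_order {N : ℕ} {q : MvPowerSeries (Fin n) F} :
    q ∈ orderIdeal F n N ↔ (N : ℕ∞) ≤ q.order :=
  ⟨fun h => nat_le_order h, fun h _ hd => coeff_of_lt_order ((Nat.cast_lt.2 hd).trans_le h)⟩

theorem mem_orderIdeal_zero (q : MvPowerSeries (Fin n) F) : q ∈ orderIdeal F n 0 :=
  fun _ hd => absurd hd (Nat.not_lt_zero _)

theorem orderIdeal_anti {M N : ℕ} (h : M ≤ N) : orderIdeal F n N ≤ orderIdeal F n M :=
  fun _ hq d hd => hq d (hd.trans_le h)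

theorem mul_mem_orderIdeal {M N : ℕ} {p q : MvPowerSeries (Fin n) F} (hp : p ∈ orderIdeal F n M)
    (hq : q ∈ orderIdeal F n N) : p * q ∈ orderIdeal F n (M + N) := by
  rw [mem_orderIdeal_iff_le_order] at *
  push_cast
  exact (add_le_add hp hq).trans le_order_mul

theorem smul_mem_orderIdeal {N : ℕ} {q : MvPowerSeries (Fin n) F} (c : F)
    (hq : q ∈ orderIdeal F n N) : c • q ∈ orderIdeal F n N := fun d hd => by
  rw [coeff_smul, hq d hd, mul_zero]

theorem eq_zero_of_forall_mem_orderIdeal {q : MvPowerSeries (Fin n) F}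
    (h : ∀ N, q ∈ orderIdeal F n N) : q = 0 := by
  ext d
  exact h (d.degree + 1) d (Nat.lt_succ_self _)

theorem eq_of_forall_sub_mem_orderIdeal {p q : MvPowerSeries (Fin n) F}
    (h : ∀ N, p - q ∈ orderIdeal F n N) : p = q :=
  sub_eq_zero.1 (eq_zero_of_forall_mem_orderIdeal h)

theorem mem_orderIdeal_one {q : MvPowerSeries (Fin n) F} :
    q ∈ orderIdeal F n 1 ↔ constantCoeff q = 0 := by
  rw [mem_orderIdeal]
  refine ⟨fun h => ?_, fun h d hd => ?_⟩
  · rw [← coeff_zero_eq_constantCoeff_apply]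
    exact h 0 (by simp)
  · rw [Nat.lt_one_iff, Finsupp.degree_eq_zero_iff] at hd
    rw [hd, coeff_zero_eq_constantCoeff_apply, h]

theorem X_mem_orderIdeal (i : Fin n) : (X i : MvPowerSeries (Fin n) F) ∈ orderIdeal F n 1 := by
  simp [mem_orderIdeal_one]

/-- The order of a product of power series over a field is the sum of the orders. -/
theorem order_mul' (p q : MvPowerSeries (Fin n) F) : (p * q).order = p.order + q.order := by
  rcases eq_or_ne p 0 with rfl | hp
  · simp
  rcases eq_or_ne q 0 with rfl | hq
  · simp
  refine le_antisymm ?_ le_order_mul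
  rw [ne_zero_iff_order_finite] at hp hq
  -- Were the order larger, the product of the two lowest homogeneous components would vanish,
  -- although neither factor does.
  by_contra! h
  rw [← hp, ← hq, ← Nat.cast_add] at h
  have h0 := homogeneousComponent_of_lt_order_eq_zero h
  rw [homogeneousComponent_mul_of_le_order hp.le hq.le] at h0
  exact (mul_ne_zero (homogeneousComponent_of_order hp) (homogeneousComponent_of_order hq)) h0

theorem mem_orderIdeal_of_mul_mem {M N : ℕ} {p q : MvPowerSeries (Fin n) F}
    (hp : p ∉ orderIdeal F n (M + 1)) (h : p * q ∈ orderIdeal F n (M + N)) :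
    q ∈ orderIdeal F n N := by
  rw [mem_orderIdeal_iff_le_order] at *
  rw [order_mul'] at h
  have hp' : p.order ≤ M := by
    rw [not_le] at hp
    push_cast at hp
    exact Order.le_of_lt_add_one hp
  by_contra! hq
  have h2 := h.trans (add_le_add_left hp' _)
  push_cast at h2
  have := ENat.add_lt_add_iff_left (ENat.natCast_ne_top M) |>.2 hq
  exact absurd h2 (not_le.2 this)

theorem coeff_add_single_X_mul (i : Fin n) (d : Fin n →₀ ℕ) (q : MvPowerSeries (Fin n) F) :
    coeff (d + Finsupp.single i 1) (X i * q) = coeff d q := by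
  rw [add_comm, X, coeff_add_monomial_mul, one_mul]

theorem coeff_X_mul_of_eq_zero {i : Fin n} {d : Fin n →₀ ℕ} (h : d i = 0)
    (q : MvPowerSeries (Fin n) F) : coeff d (X i * q) = 0 := by
  classical
  rw [X, coeff_monomial_mul, if_neg]
  intro h'
  have := h' i
  simp [h] at this

/-- A power series in `orderIdeal F n (N + 1)` is a combination of the variables with coefficients
in `orderIdeal F n N`. -/
theorem exists_eq_sum_X_mul {N : ℕ} {q : MvPowerSeries (Fin n) F}
    (hq : q ∈ orderIdeal F n (N + 1)) :
    ∃ c : Fin n → MvPowerSeries (Fin n) F, (∀ i, c i ∈ orderIdeal F n N) ∧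
      q = ∑ i, X i * c i := by
  classical
  -- Each monomial is charged to the first variable dividing it, so it is counted exactly once.
  refine ⟨fun i => ofCoeff fun d =>
    if ∀ j < i, d j = 0 then coeff (d + Finsupp.single i 1) q else 0, fun i d hd => ?_, ?_⟩
  · rw [coeff_ofCoeff]
    split_ifs
    · apply hq
      simpa using hd
    · rfl
  · ext d
    rw [map_sum]
    by_cases hd : d = 0
    · subst hd
      rw [hq 0 (by simp), Finset.sum_eq_zero]
      intro i _
      exact coeff_X_mul_of_eq_zero rfl _
    · have hex : ∃ i, d i ≠ 0 := by
        by_contra! h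
        exact hd (Finsupp.ext h)
      obtain ⟨i, hi, hmin⟩ : ∃ i, d i ≠ 0 ∧ ∀ j < i, d j = 0 := by
        have hne : (Finset.univ.filter fun i => d i ≠ 0).Nonempty := by
          obtain ⟨i, hi⟩ := hex
          exact ⟨i, by simpa using hi⟩
        refine ⟨_, (Finset.mem_filter.1 (Finset.min'_mem _ hne)).2, fun j hj => ?_⟩
        by_contra hj'
        exact absurd (Finset.min'_le _ j (Finset.mem_filter.2 ⟨Finset.mem_univ _, hj'⟩))
          (not_le.2 hj)
      obtain ⟨e, rfl⟩ : ∃ e, d = e + Finsupp.single i 1 :=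
        ⟨d - Finsupp.single i 1, (tsub_add_cancel_of_le (by
          rw [Finsupp.single_le_iff]; exact Nat.one_le_iff_ne_zero.2 hi)).symm⟩
      rw [Finset.sum_eq_single i]
      · rw [coeff_add_single_X_mul, coeff_ofCoeff, if_pos]
        intro j hj
        simpa [Finsupp.single_apply, hj.ne'] using hmin j hj
      · intro j _ hji
        rcases lt_or_gt_of_ne hji with hlt | hgt
        · exact coeff_X_mul_of_eq_zero (hmin j hlt) _
        · by_cases hj0 : (e + Finsupp.single i 1 : Fin n →₀ ℕ) j = 0
          · exact coeff_X_mul_of_eq_zero hj0 _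
          · obtain ⟨e', he'⟩ : ∃ e', e + Finsupp.single i 1 = e' + Finsupp.single j 1 :=
              ⟨_, (tsub_add_cancel_of_le (by
                rw [Finsupp.single_le_iff]; exact Nat.one_le_iff_ne_zero.2 hj0)).symm⟩
            rw [he', coeff_add_single_X_mul, coeff_ofCoeff, if_neg]
            intro h
            have h1 := h i hgt
            have h2 := DFunLike.congr_fun he' i
            simp [h1, hgt.ne'] at h2
      · simp

theorem exists_eq_C_add_sum_X_mul (q : MvPowerSeries (Fin n) F) :
    ∃ c : Fin n → MvPowerSeries (Fin n) F, q = C (constantCoeff q) + ∑ i, X i * c i := by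
  obtain ⟨c, -, hc⟩ := exists_eq_sum_X_mul (N := 0) (q := q - C (constantCoeff q))
    (by simp [mem_orderIdeal_one])
  exact ⟨c, by rw [← hc]; ring⟩

theorem sum_X_mul_mem_orderIdeal {N : ℕ} {c : Fin n → MvPowerSeries (Fin n) F}
    (h : ∀ i, c i ∈ orderIdeal F n N) : ∑ i, X i * c i ∈ orderIdeal F n (N + 1) := by
  refine Ideal.sum_mem _ fun i _ => ?_
  rw [add_comm]
  exact mul_mem_orderIdeal (X_mem_orderIdeal i) (h i)

/-- A derivation of the ring of power series vanishes if it vanishes on the variables. -/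
theorem derivation_eq_zero {D : Derivation F (MvPowerSeries (Fin n) F) (MvPowerSeries (Fin n) F)}
    (h : ∀ i, D (X i) = 0) : D = 0 := by
  ext1 q
  refine eq_zero_of_forall_mem_orderIdeal fun N => ?_
  induction N generalizing q with
  | zero => exact mem_orderIdeal_zero _
  | succ N ih =>
    obtain ⟨c, hc⟩ := exists_eq_C_add_sum_X_mul q
    have h0 : D (C (constantCoeff q)) = 0 := D.map_algebraMap _
    rw [hc, map_add, h0, zero_add, map_sum]
    simp only [Derivation.leibniz, h, smul_eq_mul, mul_zero, add_zero]
    exact sum_X_mul_mem_orderIdeal fun i => ih (c i)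

theorem derivation_ext_X
    {D D' : Derivation F (MvPowerSeries (Fin n) F) (MvPowerSeries (Fin n) F)}
    (h : ∀ i, D (X i) = D' (X i)) : D = D' :=
  sub_eq_zero.1 (derivation_eq_zero fun i => by rw [Derivation.sub_apply, h, sub_self])

/-- Automorphisms preserve units, hence the maximal ideal, which consists of the non-units. With
`exists_eq_sum_X_mul` this makes every algebra automorphism continuous for the order filtration, so
no continuity has to be assumed anywhere. -/
theorem algEquiv_constantCoeff (φ : MvPowerSeries (Fin n) F ≃ₐ[F] MvPowerSeries (Fin n) F)
    (q : MvPowerSeries (Fin n) F) : constantCoeff (φ q) = constantCoeff q := by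
  have key : ∀ p : MvPowerSeries (Fin n) F, constantCoeff p = 0 → constantCoeff (φ p) = 0 := by
    intro p hp
    by_contra h
    have h1 : IsUnit (φ p) := isUnit_iff_constantCoeff.2 (isUnit_iff_ne_zero.2 h)
    have h2 : IsUnit p := by simpa using h1.map φ.symm
    exact (isUnit_iff_constantCoeff.1 h2).ne_zero hp
  have h := key (q - C (constantCoeff q)) (by simp)
  have hC : φ (C (constantCoeff q)) = C (constantCoeff q) := φ.commutes _
  rw [map_sub, hC, map_sub, constantCoeff_C] at h
  exact sub_eq_zero.1 h

theorem algEquiv_mem_orderIdeal (φ : MvPowerSeries (Fin n) F ≃ₐ[F] MvPowerSeries (Fin n) F)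
    {N : ℕ} {q : MvPowerSeries (Fin n) F} (hq : q ∈ orderIdeal F n N) :
    φ q ∈ orderIdeal F n N := by
  induction N generalizing q with
  | zero => exact mem_orderIdeal_zero _
  | succ N ih =>
    obtain ⟨c, hc, rfl⟩ := exists_eq_sum_X_mul hq
    rw [map_sum]
    refine Ideal.sum_mem _ fun i _ => ?_
    rw [map_mul, add_comm]
    refine mul_mem_orderIdeal ?_ (ih (hc i))
    rw [mem_orderIdeal_one, algEquiv_constantCoeff, constantCoeff_X]

theorem algEquiv_eq_one {φ : MvPowerSeries (Fin n) F ≃ₐ[F] MvPowerSeries (Fin n) F}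
    (h : ∀ i, φ (X i) = X i) : φ = 1 := by
  ext1 q
  refine eq_of_forall_sub_mem_orderIdeal fun N => ?_
  induction N generalizing q with
  | zero => exact mem_orderIdeal_zero _
  | succ N ih =>
    obtain ⟨c, hc⟩ := exists_eq_C_add_sum_X_mul q
    have hC : φ (C (constantCoeff q)) = C (constantCoeff q) := φ.commutes _
    have : φ q - q = ∑ i, X i * (φ (c i) - c i) := by
      conv_lhs => rw [hc]
      rw [map_add, hC, map_sum]
      simp only [map_mul, h, mul_sub, Finset.sum_sub_distrib]
      ring
    change φ q - q ∈ _
    rw [this]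
    exact sum_X_mul_mem_orderIdeal fun i => ih (c i)

end OrderFiltration

/-! ### Exponentials of order-raising operators. -/

section Exponential

variable {F : Type*} [Field F]

/-- The linear map `L` raises the order of every power series by at least `m`. -/
def RaisesOrder (L : Module.End F (PS F)) (m : ℕ) : Prop :=
  ∀ N, ∀ q ∈ orderIdeal F 3 N, L q ∈ orderIdeal F 3 (N + m)

theorem RaisesOrder.pow {L : Module.End F (PS F)} (h : RaisesOrder L 1) (k : ℕ) :
    RaisesOrder (L ^ k) k := by
  induction k with
  | zero => exact fun N q hq => hq
  | succ k ih =>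
    intro N q hq
    rw [pow_succ', Module.End.mul_apply]
    exact h _ _ (ih _ _ hq)

theorem RaisesOrder.pow_mem {L : Module.End F (PS F)} (h : RaisesOrder L 1) (k : ℕ) (q : PS F) :
    (L ^ k) q ∈ orderIdeal F 3 k := by
  simpa using h.pow k 0 q (mem_orderIdeal_zero q)

/-- The exponential `∑ Lⁿ q / n!` of an operator that raises the order. -/
def expOp (L : Module.End F (PS F)) (q : PS F) : PS F :=
  ofCoeff fun d => ∑ n ∈ Finset.range (d.degree + 1),
    ((n.factorial : F))⁻¹ * coeff d ((L ^ n) q)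

/-- A partial sum of the exponential series. -/
def expPartial (L : Module.End F (PS F)) (N : ℕ) (q : PS F) : PS F :=
  ∑ n ∈ Finset.range N, ((n.factorial : F))⁻¹ • (L ^ n) q

variable {L L' : Module.End F (PS F)}

theorem expOp_sub_expPartial_mem (h : RaisesOrder L 1) (N : ℕ) (q : PS F) :
    expOp L q - expPartial L N q ∈ orderIdeal F 3 N := by
  intro d hd
  rw [map_sub, sub_eq_zero, expOp, coeff_ofCoeff, expPartial, map_sum]
  simp only [coeff_smul]
  refine Finset.sum_subset (Finset.range_mono hd) fun n _ hn => ?_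
  rw [h.pow_mem n q d (by simpa using hn), mul_zero]

theorem expOp_add (p q : PS F) : expOp L (p + q) = expOp L p + expOp L q := by
  ext d
  simp only [expOp, coeff_ofCoeff, map_add, mul_add, Finset.sum_add_distrib]

theorem expOp_smul (c : F) (q : PS F) : expOp L (c • q) = c • expOp L q := by
  ext d
  simp only [expOp, coeff_ofCoeff, map_smul, smul_eq_mul, Finset.mul_sum]
  exact Finset.sum_congr rfl fun _ _ => mul_left_comm _ _ _

theorem expOp_sub (p q : PS F) : expOp L (p - q) = expOp L p - expOp L q := by
  have h := expOp_add (L := L) (p - q) q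
  rw [sub_add_cancel] at h
  rw [h, add_sub_cancel_right]

theorem expOp_mem_orderIdeal (h : RaisesOrder L 1) {N : ℕ} {q : PS F}
    (hq : q ∈ orderIdeal F 3 N) : expOp L q ∈ orderIdeal F 3 N := by
  intro d hd
  rw [expOp, coeff_ofCoeff]
  refine Finset.sum_eq_zero fun n _ => ?_
  rw [h.pow n N q hq d (by omega), mul_zero]

theorem expOp_sub_self_mem (h : RaisesOrder L 1) {N : ℕ} {q : PS F}
    (hq : q ∈ orderIdeal F 3 N) : expOp L q - q ∈ orderIdeal F 3 (N + 1) := by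
  have h1 := expOp_sub_expPartial_mem h (N + 1) q
  have h2 : expPartial L (N + 1) q - q ∈ orderIdeal F 3 (N + 1) := by
    rw [expPartial, Finset.sum_range_succ']
    simp only [pow_zero, Module.End.one_apply, Nat.factorial_zero, Nat.cast_one, inv_one, one_smul,
      add_sub_cancel_right]
    refine Ideal.sum_mem _ fun n _ => smul_mem_orderIdeal _ ?_
    exact orderIdeal_anti (by omega) (h.pow (n + 1) N q hq)
  simpa using add_mem h1 h2

theorem constantCoeff_expOp (h : RaisesOrder L 1) (q : PS F) :
    constantCoeff (expOp L q) = constantCoeff q := by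
  have := mem_orderIdeal_one.1 (expOp_sub_self_mem h (mem_orderIdeal_zero q))
  rwa [map_sub, sub_eq_zero] at this

/-- Operators that commute up to a relation `T L = L' T` transport exponentials. -/
theorem map_expOp {T : Module.End F (PS F)} (hL : RaisesOrder L 1) (hL' : RaisesOrder L' 1)
    (k : ℕ) (hT : ∀ N, ∀ q ∈ orderIdeal F 3 (N + k), T q ∈ orderIdeal F 3 N)
    (h : ∀ q, T (L q) = L' (T q)) (q : PS F) : T (expOp L q) = expOp L' (T q) := by
  refine eq_of_forall_sub_mem_orderIdeal fun N => ?_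
  -- The shift k is the amount by which T may lower the order; k = 1 is needed for ∂x.
  have h1 := hT N _ (expOp_sub_expPartial_mem hL (N + k) q)
  have h2 := orderIdeal_anti (Nat.le_add_right N k)
    (expOp_sub_expPartial_mem hL' (N + k) (T q))
  have hpow : ∀ n, T ((L ^ n) q) = (L' ^ n) (T q) := by
    intro n
    induction n with
    | zero => rfl
    | succ n ih => rw [pow_succ', Module.End.mul_apply, h, ih, pow_succ', Module.End.mul_apply]
  have h3 : T (expPartial L (N + k) q) = expPartial L' (N + k) (T q) := by
    simp only [expPartial, map_sum, map_smul, hpow]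
  rw [map_sub, h3] at h1
  simpa using sub_mem h1 h2

/-- If `L` and `L'` agree up to order `m`, then their exponentials agree up to order `m`, with the
same difference in the lowest order. -/
theorem expOp_sub_expOp_sub_mem (hL : RaisesOrder L 1) (hL' : RaisesOrder L' 1) {m : ℕ}
    (h : RaisesOrder (L - L') m) {N : ℕ} {q : PS F} (hq : q ∈ orderIdeal F 3 N) :
    expOp L q - expOp L' q - (L q - L' q) ∈ orderIdeal F 3 (N + m + 1) := by
  -- Telescoping: L^(n+2) - L'^(n+2) = L (L^(n+1) - L'^(n+1)) + (L - L') L'^(n+1). All powers beyond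
  -- the first thus contribute only in order N + m + 1 and higher.
  have hpow : ∀ n, (L ^ (n + 1)) q - (L' ^ (n + 1)) q ∈ orderIdeal F 3 (N + m + n) := by
    intro n
    induction n with
    | zero => simpa using h N q hq
    | succ n ih =>
      rw [pow_succ' L, pow_succ' L', Module.End.mul_apply, Module.End.mul_apply]
      have h1 := hL _ _ ih
      have h2 := orderIdeal_anti (by omega : N + m + (n + 1) ≤ N + (n + 1) + m)
        (h _ _ (hL'.pow (n + 1) N q hq))
      rw [map_sub] at h1
      rw [LinearMap.sub_apply] at h2
      have h3 := add_mem h1 h2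
      rwa [sub_add_sub_cancel] at h3
  have h1 := expOp_sub_expPartial_mem hL (N + m + 2) q
  have h2 := expOp_sub_expPartial_mem hL' (N + m + 2) q
  have h3 : expPartial L (N + m + 2) q - expPartial L' (N + m + 2) q - (L q - L' q) ∈
      orderIdeal F 3 (N + m + 1) := by
    have e : expPartial L (N + m + 2) q - expPartial L' (N + m + 2) q - (L q - L' q) =
        ∑ n ∈ Finset.range (N + m), (((n + 1 + 1).factorial : F))⁻¹ •
          ((L ^ (n + 1 + 1)) q - (L' ^ (n + 1 + 1)) q) := by
      simp only [expPartial, Finset.sum_range_succ', smul_sub, Finset.sum_sub_distrib]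
      simp
      abel
    rw [e]
    refine Ideal.sum_mem _ fun n _ => smul_mem_orderIdeal _ ?_
    exact orderIdeal_anti (by omega) (hpow (n + 1))
  have h4 := orderIdeal_anti (Nat.le_succ _) (sub_mem h1 h2)
  have h5 := add_mem h4 h3
  convert h5 using 1
  ring

theorem RaisesOrder.neg {m : ℕ} (h : RaisesOrder L m) : RaisesOrder (-L) m := fun N q hq => by
  rw [LinearMap.neg_apply]
  exact neg_mem (h N q hq)

/-- Divided powers satisfy D A_k = (k+1) A_(k+1). The convolution of two such sequences inherits the
relation, on splitting n + 1 as the sum of the two indices; this is the inductive step of the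
Leibniz rule below. -/
theorem derivation_sum_antidiagonal (D : VF F) {A B : ℕ → PS F}
    (hA : ∀ k, D (A k) = ((k + 1 : ℕ) : F) • A (k + 1))
    (hB : ∀ k, D (B k) = ((k + 1 : ℕ) : F) • B (k + 1)) (n : ℕ) :
    D (∑ x ∈ Finset.HasAntidiagonal.antidiagonal n, A x.1 * B x.2) =
      ((n + 1 : ℕ) : F) • ∑ x ∈ Finset.HasAntidiagonal.antidiagonal (n + 1), A x.1 * B x.2 := by
  rw [map_sum, Finset.smul_sum]
  have e1 : ∀ x ∈ Finset.HasAntidiagonal.antidiagonal (n + 1),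
      ((n + 1 : ℕ) : F) • (A x.1 * B x.2) =
        (x.1 : F) • (A x.1 * B x.2) + (x.2 : F) • (A x.1 * B x.2) := by
    intro x hx
    rw [← add_smul, ← Nat.cast_add, Finset.HasAntidiagonal.mem_antidiagonal.1 hx]
  rw [Finset.sum_congr rfl e1, Finset.sum_add_distrib,
    Finset.Nat.sum_antidiagonal_succ (f := fun x => (x.1 : F) • (A x.1 * B x.2)),
    Finset.Nat.sum_antidiagonal_succ' (f := fun x => (x.2 : F) • (A x.1 * B x.2))]
  simp only [Nat.cast_zero, zero_smul, zero_add, Derivation.leibniz, smul_eq_mul, hA, hB]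
  rw [Finset.sum_add_distrib, add_comm]
  congr 1
  · exact Finset.sum_congr rfl fun x _ => by rw [mul_smul_comm, mul_comm]
  · exact Finset.sum_congr rfl fun x _ => by rw [mul_smul_comm]

variable [CharZero F]

theorem factorial_inv_succ (n : ℕ) :
    ((n + 1 : ℕ) : F) * (((n + 1).factorial : F))⁻¹ = ((n.factorial : F))⁻¹ := by
  have h1 : ((n + 1 : ℕ) : F) ≠ 0 := Nat.cast_ne_zero.2 (Nat.succ_ne_zero n)
  have h2 : (n.factorial : F) ≠ 0 := Nat.cast_ne_zero.2 n.factorial_ne_zero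
  rw [Nat.factorial_succ]
  push_cast at *
  field_simp

/-- The Leibniz rule for the divided powers of a derivation. -/
theorem derivation_dividedPower_mul (D : VF F) (p q : PS F) (n : ℕ) :
    ((n.factorial : F))⁻¹ • (D.toLinearMap ^ n) (p * q) = ∑ k ∈ Finset.range (n + 1),
      (((k.factorial : F))⁻¹ • (D.toLinearMap ^ k) p) *
        (((n - k).factorial : F))⁻¹ • (D.toLinearMap ^ (n - k)) q := by
  have hD : ∀ (p : PS F) (k : ℕ), D (((k.factorial : F))⁻¹ • (D.toLinearMap ^ k) p) =
      ((k + 1 : ℕ) : F) • (((k + 1).factorial : F))⁻¹ • (D.toLinearMap ^ (k + 1)) p := by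
    intro p k
    rw [smul_smul, factorial_inv_succ, Derivation.map_smul, pow_succ', Module.End.mul_apply]
    rfl
  rw [← Finset.Nat.sum_antidiagonal_eq_sum_range_succ
    (fun i j => (((i.factorial : F))⁻¹ • (D.toLinearMap ^ i) p) *
      ((j.factorial : F))⁻¹ • (D.toLinearMap ^ j) q)]
  induction n with
  | zero => simp
  | succ n ih =>
    have hne : ((n + 1 : ℕ) : F) ≠ 0 := Nat.cast_ne_zero.2 (Nat.succ_ne_zero n)
    have h1 := derivation_sum_antidiagonal D (hD p) (hD q) n
    rw [← ih, hD] at h1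
    exact smul_right_injective (PS F) hne h1

theorem expOp_mul {D : VF F} (h : RaisesOrder D.toLinearMap 1) (p q : PS F) :
    expOp D.toLinearMap (p * q) = expOp D.toLinearMap p * expOp D.toLinearMap q := by
  refine eq_of_forall_sub_mem_orderIdeal fun N => ?_
  set L := D.toLinearMap
  have h0 := expOp_sub_expPartial_mem h N (p * q)
  have hp := expOp_sub_expPartial_mem h N p
  have hq := expOp_sub_expPartial_mem h N q
  have h1 : expPartial L N (p * q) - expPartial L N p * expPartial L N q ∈ orderIdeal F 3 N := by
    set f : ℕ → ℕ → PS F := fun i j =>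
      (((i.factorial : F))⁻¹ • (L ^ i) p) * ((j.factorial : F))⁻¹ • (L ^ j) q with hf
    have e1 : expPartial L N (p * q) = ∑ i ∈ Finset.range N, ∑ j ∈ Finset.range (N - i), f i j := by
      rw [← Finset.sum_range_diag_flip]
      exact Finset.sum_congr rfl fun n _ => derivation_dividedPower_mul D p q n
    have e2 : expPartial L N p * expPartial L N q =
        ∑ i ∈ Finset.range N, ∑ j ∈ Finset.range N, f i j := by
      rw [expPartial, expPartial, Finset.sum_mul_sum]
    rw [e1, e2, ← Finset.sum_sub_distrib]
    refine Ideal.sum_mem _ fun i _ => ?_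
    -- The square of indices i, j < N exceeds the triangle i + j < N only by terms with i + j ≥ N,
    -- which have order at least N.
    rw [← neg_mem_iff, neg_sub, ← Finset.sum_sdiff (Finset.range_mono (Nat.sub_le N i)),
      add_sub_cancel_right]
    refine Ideal.sum_mem _ fun j hj => ?_
    rw [Finset.mem_sdiff, Finset.mem_range, Finset.mem_range] at hj
    refine orderIdeal_anti (by omega : N ≤ i + j) (mul_mem_orderIdeal ?_ ?_)
    · exact smul_mem_orderIdeal _ (h.pow_mem i p)
    · exact smul_mem_orderIdeal _ (h.pow_mem j q)
  have h2 := Ideal.mul_mem_right (expOp L q) _ hp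
  have h3 := Ideal.mul_mem_left _ (expPartial L N p) hq
  have h4 := sub_mem (add_mem h0 h1) (add_mem h2 h3)
  convert h4 using 1
  ring

end Exponential

/-! ### The fields E and Θ⁰₀, and exponentials of multiples of E. -/

section Fields

variable {F : Type*} [Field F]

theorem coeff_X_mul_pderiv (i : Fin 3) (d : Fin 3 →₀ ℕ) (q : PS F) :
    coeff d (X i * pderiv F i q) = d i * coeff d q := by
  by_cases hd : d i = 0
  · rw [coeff_X_mul_of_eq_zero hd, hd, Nat.cast_zero, zero_mul]
  · obtain ⟨e, rfl⟩ : ∃ e, d = e + Finsupp.single i 1 :=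
      ⟨d - Finsupp.single i 1, (tsub_add_cancel_of_le (by
        rw [Finsupp.single_le_iff]; exact Nat.one_le_iff_ne_zero.2 hd)).symm⟩
    rw [coeff_add_single_X_mul, coeff_pderiv]
    simp [mul_comm]

theorem euler_apply (q : PS F) : euler F q = X 0 * pderiv F 0 q +
    (2⁻¹ : F) • (X 1 * pderiv F 1 q) + (2⁻¹ : F) • (X 2 * pderiv F 2 q) := rfl

theorem rot_apply (q : PS F) : rot F q = X 2 * pderiv F 1 q - X 1 * pderiv F 2 q := rfl

theorem coeff_euler (d : Fin 3 →₀ ℕ) (q : PS F) :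
    coeff d (euler F q) = (d 0 + 2⁻¹ * d 1 + 2⁻¹ * d 2) * coeff d q := by
  rw [euler_apply, map_add, map_add, coeff_smul, coeff_smul, coeff_X_mul_pderiv,
    coeff_X_mul_pderiv, coeff_X_mul_pderiv]
  ring

@[simp]
theorem euler_X_zero : euler F (X 0) = X 0 := by
  simp [euler_apply]

@[simp]
theorem euler_X_one : euler F (X 1) = (2⁻¹ : F) • X 1 := by
  simp [euler_apply]

@[simp]
theorem euler_X_two : euler F (X 2) = (2⁻¹ : F) • X 2 := by
  simp [euler_apply]

@[simp]
theorem rot_X_zero : rot F (X 0) = 0 := by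
  simp [rot_apply]

@[simp]
theorem rot_X_one : rot F (X 1) = X 2 := by
  simp [rot_apply]

@[simp]
theorem rot_X_two : rot F (X 2) = -X 1 := by
  simp [rot_apply]

@[simp]
theorem rot_rhoSq : rot F (rhoSq F) = 0 := by
  simp only [rhoSq, map_add, Derivation.leibniz_pow, rot_X_one, rot_X_two]
  simp
  ring

@[simp]
theorem pderiv_zero_rhoSq : pderiv F 0 (rhoSq F) = 0 := by
  simp [rhoSq, Derivation.leibniz_pow]

theorem euler_rot_comm (q : PS F) : euler F (rot F q) = rot F (euler F q) := by
  have h : ⁅euler F, rot F⁆ = 0 := derivation_eq_zero fun i => by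
    fin_cases i <;> simp [Derivation.commutator_apply]
  have := DFunLike.congr_fun h q
  rwa [Derivation.commutator_apply, Derivation.zero_apply, sub_eq_zero] at this

theorem pderiv_rot_comm (q : PS F) : pderiv F 0 (rot F q) = rot F (pderiv F 0 q) := by
  have h : ⁅(pderiv F 0 : VF F), rot F⁆ = 0 := derivation_eq_zero fun i => by
    fin_cases i <;> simp [Derivation.commutator_apply]
  have := DFunLike.congr_fun h q
  rwa [Derivation.commutator_apply, Derivation.zero_apply, sub_eq_zero] at this

theorem pderiv_euler (q : PS F) :
    pderiv F 0 (euler F q) = euler F (pderiv F 0 q) + pderiv F 0 q := by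
  have h : ⁅(pderiv F 0 : VF F), euler F⁆ - (pderiv F 0 : VF F) = 0 :=
      derivation_eq_zero fun i => by
    fin_cases i <;> simp [Derivation.commutator_apply]
  have := DFunLike.congr_fun h q
  rw [Derivation.sub_apply, Derivation.commutator_apply, Derivation.zero_apply] at this
  linear_combination this

theorem euler_mem_orderIdeal {N : ℕ} {q : PS F} (hq : q ∈ orderIdeal F 3 N) :
    euler F q ∈ orderIdeal F 3 N := fun d hd => by
  rw [coeff_euler, hq d hd, mul_zero]

theorem rhoSq_mem_orderIdeal : rhoSq F ∈ orderIdeal F 3 2 := by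
  rw [rhoSq, pow_two, pow_two]
  exact add_mem (mul_mem_orderIdeal (X_mem_orderIdeal 1) (X_mem_orderIdeal 1))
    (mul_mem_orderIdeal (X_mem_orderIdeal 2) (X_mem_orderIdeal 2))

theorem raisesOrder_smul_euler {m : ℕ} {g : PS F} (hg : g ∈ orderIdeal F 3 m) :
    RaisesOrder (g • euler F).toLinearMap m := fun N q hq => by
  change g * euler F q ∈ _
  rw [add_comm]
  exact mul_mem_orderIdeal hg (euler_mem_orderIdeal hq)

/-- `Dⁿ (u a) = (D + l)ⁿ u a` when `D a = l a`. -/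
theorem pow_derivation_mul_of_eigen {D : VF F} {a l : PS F} (h : D a = l * a) (n : ℕ) (u : PS F) :
    (D.toLinearMap ^ n) (u * a) = ((D.toLinearMap + LinearMap.mulLeft F l) ^ n) u * a := by
  induction n with
  | zero => rfl
  | succ n ih =>
    rw [pow_succ', Module.End.mul_apply, ih, pow_succ', Module.End.mul_apply]
    set v := ((D.toLinearMap + LinearMap.mulLeft F l) ^ n) u
    change D (v * a) = (D v + l * v) * a
    rw [Derivation.leibniz, h, smul_eq_mul, smul_eq_mul]
    ring

theorem raisesOrder_add_mulLeft {D : VF F} (hD : RaisesOrder D.toLinearMap 1) {l : PS F}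
    (hl : constantCoeff l = 0) :
    RaisesOrder (D.toLinearMap + LinearMap.mulLeft F l) 1 := fun N q hq => by
  refine add_mem (hD N q hq) ?_
  rw [add_comm]
  exact mul_mem_orderIdeal (mem_orderIdeal_one.2 hl) hq

/-- If `D a = l a`, then the exponential of `D` multiplies `a` by a series with constant
coefficient `1` that depends only on `D` and `l`. -/
theorem expOp_eigen {D : VF F} (hD : RaisesOrder D.toLinearMap 1) {a l : PS F}
    (hl : constantCoeff l = 0) (h : D a = l * a) :
    expOp D.toLinearMap a = expOp (D.toLinearMap + LinearMap.mulLeft F l) 1 * a := by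
  -- Multiplication by a intertwines D + l with D; apply this to the series 1.
  have key := map_expOp (T := LinearMap.mulRight F a) (raisesOrder_add_mulLeft hD hl) hD 0
    (fun N q hq => Ideal.mul_mem_right _ _ hq) (fun q => by
      simpa using (pow_derivation_mul_of_eigen h 1 q).symm) 1
  simpa using key.symm

end Fields

/-! ### Existence of formal flows. -/

section Flow

variable {F : Type*} [Field F]

theorem isExp_iff {S : VF F} {φ : PS F ≃ₐ[F] PS F} :
    IsExp S φ ↔ ∀ q, φ q = expOp S.toLinearMap q := by
  have e : ∀ (n : ℕ) (q : PS F), (fun h => S h)^[n] q = (S.toLinearMap ^ n) q := fun n q => by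
    rw [Module.End.pow_apply]; rfl
  constructor
  · intro h q
    ext d
    rw [h q d, expOp, coeff_ofCoeff]
    simp only [e]
  · intro h q d
    rw [h q, expOp, coeff_ofCoeff]
    simp only [e]

variable [CharZero F]

theorem sum_inv_factorial_alternating {n : ℕ} (hn : n ≠ 0) :
    ∑ k ∈ Finset.range (n + 1),
      (-1 : F) ^ k * ((k.factorial : F))⁻¹ * (((n - k).factorial : F))⁻¹ = 0 := by
  have h1 := congrArg (Int.cast : ℤ → F) (Int.alternating_sum_range_choose_of_ne hn)
  push_cast at h1
  have hf : ∀ m : ℕ, (m.factorial : F) ≠ 0 := fun m => Nat.cast_ne_zero.2 m.factorial_ne_zero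
  apply (mul_right_injective₀ (hf n))
  simp only [mul_zero]
  rw [← h1, Finset.mul_sum]
  refine Finset.sum_congr rfl fun k hk => ?_
  rw [Nat.cast_choose F (Nat.lt_succ_iff.1 (Finset.mem_range.1 hk))]
  have := hf k
  have := hf (n - k)
  field_simp

theorem expOp_neg_expOp {L : Module.End F (PS F)} (h : RaisesOrder L 1) (q : PS F) :
    expOp (-L) (expOp L q) = q := by
  refine eq_of_forall_sub_mem_orderIdeal fun N => ?_
  refine orderIdeal_anti (Nat.le_succ N) ?_
  have h1 := expOp_mem_orderIdeal h.neg (expOp_sub_expPartial_mem h (N + 1) q)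
  have h2 := expOp_sub_expPartial_mem h.neg (N + 1) (expPartial L (N + 1) q)
  rw [expOp_sub] at h1
  have h3 : expPartial (-L) (N + 1) (expPartial L (N + 1) q) - q ∈ orderIdeal F 3 (N + 1) := by
    set f : ℕ → ℕ → PS F := fun i j =>
      ((-1) ^ i * ((i.factorial : F))⁻¹ * ((j.factorial : F))⁻¹) • (L ^ (i + j)) q with hf
    have e1 : expPartial (-L) (N + 1) (expPartial L (N + 1) q) =
        ∑ i ∈ Finset.range (N + 1), ∑ j ∈ Finset.range (N + 1), f i j := by
      simp only [expPartial, map_sum, Finset.smul_sum, hf]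
      refine Finset.sum_congr rfl fun i _ => Finset.sum_congr rfl fun j _ => ?_
      rw [← neg_one_smul F L, smul_pow, map_smul, pow_add, Module.End.mul_apply,
        LinearMap.smul_apply, smul_smul, smul_smul]
      congr 1
      ring
    have e2 : q = ∑ i ∈ Finset.range (N + 1), ∑ j ∈ Finset.range (N + 1 - i), f i j := by
      rw [← Finset.sum_range_diag_flip, Finset.sum_range_succ', Finset.sum_eq_zero]
      · simp [hf]
      · intro n _
        have : ∀ k ∈ Finset.range (n + 1 + 1), f k (n + 1 - k) =
            ((-1) ^ k * ((k.factorial : F))⁻¹ * (((n + 1 - k).factorial : F))⁻¹) •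
              (L ^ (n + 1)) q := by
          intro k hk
          simp only [hf]
          rw [Nat.add_sub_cancel' (Nat.lt_succ_iff.1 (Finset.mem_range.1 hk))]
        rw [Finset.sum_congr rfl this, ← Finset.sum_smul,
          sum_inv_factorial_alternating n.succ_ne_zero, zero_smul]
    -- On the triangle i + j ≤ N the alternating binomial sums leave only the term q; the rest of
    -- the square has order greater than N.
    rw [e1, show _ - q = _ - _ from congrArg (_ - ·) e2, ← Finset.sum_sub_distrib]
    refine Ideal.sum_mem _ fun i _ => ?_
    rw [← Finset.sum_sdiff (Finset.range_mono (Nat.sub_le (N + 1) i)), add_sub_cancel_right]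
    refine Ideal.sum_mem _ fun j hj => smul_mem_orderIdeal _ ?_
    rw [Finset.mem_sdiff, Finset.mem_range, Finset.mem_range] at hj
    exact orderIdeal_anti (by omega) (h.pow_mem (i + j) q)
  simpa using add_mem (add_mem h1 h2) h3

/-- A derivation that raises the order has an exponential. -/
theorem exists_isExp {D : VF F} (h : RaisesOrder D.toLinearMap 1) : ∃ φ, IsExp D φ := by
  have h' : ∀ q, expOp D.toLinearMap (expOp (-D.toLinearMap) q) = q := fun q => by
    simpa using expOp_neg_expOp h.neg q
  let f : PS F →ₐ[F] PS F := AlgHom.ofLinearMap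
    { toFun := expOp D.toLinearMap
      map_add' := expOp_add
      map_smul' := expOp_smul }
    (by
      -- The exponential fixes 1: apply it to exp(-D) 1 = 1 · exp(-D) 1 and use multiplicativity
      -- together with exp(D) exp(-D) 1 = 1.
      have : expOp (-D.toLinearMap) 1 = 1 * expOp (-D.toLinearMap) 1 := (one_mul _).symm
      have h2 := congrArg (expOp D.toLinearMap) this
      rw [expOp_mul h, h', mul_one] at h2
      exact h2.symm)
    (expOp_mul h)
  exact ⟨AlgEquiv.ofBijective f ⟨fun a b hab => by
    rw [← expOp_neg_expOp h a, ← expOp_neg_expOp h b]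
    exact congrArg _ hab, fun b => ⟨_, h' b⟩⟩, isExp_iff.2 fun q => rfl⟩

end Flow

/-! ### Rotation-invariant series are the series in x and w. -/

section RotationInvariants

variable {F : Type*} [Field F]

/-- The exponent of `x ^ l * y ^ a * z ^ b`. -/
def expo (l a b : ℕ) : Fin 3 →₀ ℕ :=
  Finsupp.single 0 l + Finsupp.single 1 a + Finsupp.single 2 b

@[simp] theorem expo_zero (l a b : ℕ) : expo l a b 0 = l := by simp [expo]
@[simp] theorem expo_one (l a b : ℕ) : expo l a b 1 = a := by simp [expo]
@[simp] theorem expo_two (l a b : ℕ) : expo l a b 2 = b := by simp [expo]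

@[simp] theorem degree_expo (l a b : ℕ) : (expo l a b).degree = l + a + b := by
  simp [expo]

theorem expo_apply (d : Fin 3 →₀ ℕ) : expo (d 0) (d 1) (d 2) = d := by
  ext i
  fin_cases i <;> simp

theorem expo_add_single_zero (l a b : ℕ) :
    expo l a b + Finsupp.single 0 1 = expo (l + 1) a b := by
  ext i
  fin_cases i <;> simp

theorem expo_add_single_one (l a b : ℕ) :
    expo l a b + Finsupp.single 1 1 = expo l (a + 1) b := by
  ext i
  fin_cases i <;> simp

theorem expo_add_single_two (l a b : ℕ) :
    expo l a b + Finsupp.single 2 1 = expo l a (b + 1) := by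
  ext i
  fin_cases i <;> simp

theorem coeff_expo_succ_X_zero_mul (l a b : ℕ) (q : PS F) :
    coeff (expo (l + 1) a b) (X 0 * q) = coeff (expo l a b) q := by
  rw [← expo_add_single_zero, coeff_add_single_X_mul]

theorem coeff_expo_succ_X_one_mul (l a b : ℕ) (q : PS F) :
    coeff (expo l (a + 1) b) (X 1 * q) = coeff (expo l a b) q := by
  rw [← expo_add_single_one, coeff_add_single_X_mul]

theorem coeff_expo_succ_X_two_mul (l a b : ℕ) (q : PS F) :
    coeff (expo l a (b + 1)) (X 2 * q) = coeff (expo l a b) q := by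
  rw [← expo_add_single_two, coeff_add_single_X_mul]

theorem coeff_expo_zero_X_zero_mul (a b : ℕ) (q : PS F) : coeff (expo 0 a b) (X 0 * q) = 0 :=
  coeff_X_mul_of_eq_zero (by simp) q

theorem coeff_expo_zero_X_one_mul (l b : ℕ) (q : PS F) : coeff (expo l 0 b) (X 1 * q) = 0 :=
  coeff_X_mul_of_eq_zero (by simp) q

theorem coeff_expo_zero_X_two_mul (l a : ℕ) (q : PS F) : coeff (expo l a 0) (X 2 * q) = 0 :=
  coeff_X_mul_of_eq_zero (by simp) q

theorem coeff_expo_rhoSq_mul (l a : ℕ) (q : PS F) :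
    coeff (expo l (a + 2) 0) (rhoSq F * q) = coeff (expo l a 0) q := by
  rw [rhoSq, add_mul, pow_two, pow_two, mul_assoc, mul_assoc, map_add, coeff_expo_zero_X_two_mul,
    add_zero, coeff_expo_succ_X_one_mul, coeff_expo_succ_X_one_mul]

theorem coeff_expo_zero_rhoSq_mul (l : ℕ) (q : PS F) :
    coeff (expo l 0 0) (rhoSq F * q) = 0 := by
  rw [rhoSq, add_mul, pow_two, pow_two, mul_assoc, mul_assoc, map_add, coeff_expo_zero_X_two_mul,
    coeff_expo_zero_X_one_mul, add_zero]

/-- This is the coefficient of x^l y^(a+1) z^(b+1) in z ∂y q = y ∂z q. In characteristic zero it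
trades z² for y², so that an invariant series is determined by its terms free of z. -/
theorem coeff_expo_rot_relation {q : PS F} (h : rot F q = 0) (l a b : ℕ) :
    ((a + 1 : ℕ) + 1 : F) * coeff (expo l (a + 2) b) q =
      ((b + 1 : ℕ) + 1 : F) * coeff (expo l a (b + 2)) q := by
  have h1 := congrArg (coeff (expo l (a + 1) (b + 1))) h
  rw [rot_apply, map_sub, coeff_expo_succ_X_two_mul, coeff_expo_succ_X_one_mul, coeff_pderiv,
    coeff_pderiv, expo_add_single_one, expo_add_single_two, map_zero, expo_one, expo_two] at h1
  linear_combination h1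

theorem coeff_expo_one_of_rot {q : PS F} (h : rot F q = 0) (l b : ℕ) :
    coeff (expo l 1 b) q = 0 := by
  have h1 := congrArg (coeff (expo l 0 (b + 1))) h
  rw [rot_apply, map_sub, coeff_expo_succ_X_two_mul, coeff_expo_zero_X_one_mul, coeff_pderiv,
    expo_add_single_one, map_zero, expo_one] at h1
  simpa using h1

theorem coeff_expo_one_of_rot' {q : PS F} (h : rot F q = 0) (l a : ℕ) :
    coeff (expo l a 1) q = 0 := by
  have h1 := congrArg (coeff (expo l (a + 1) 0)) h
  rw [rot_apply, map_sub, coeff_expo_succ_X_one_mul, coeff_expo_zero_X_two_mul, coeff_pderiv,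
    expo_add_single_two, map_zero, expo_two] at h1
  simpa using h1

theorem planar_X_zero : planar F (X 0) = X 0 :=
  substAlgHom_X (hasSubst_planar F) 0

theorem planar_X_one : planar F (X 1) = rhoSq F :=
  substAlgHom_X (hasSubst_planar F) 1

theorem exists_planar_eq (c : MvPowerSeries (Fin 2) F) : ∃ c₁ c₂ : MvPowerSeries (Fin 2) F,
    c = C (constantCoeff c) + (X 0 * c₁ + X 1 * c₂) ∧
      planar F c = C (constantCoeff c) + (X 0 * planar F c₁ + rhoSq F * planar F c₂) := by
  obtain ⟨k, hk⟩ := exists_eq_C_add_sum_X_mul c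
  rw [Fin.sum_univ_two] at hk
  refine ⟨k 0, k 1, hk, ?_⟩
  conv_lhs => rw [hk]
  rw [map_add, map_add, map_mul, map_mul, planar_X_zero, planar_X_one]
  congr 1
  exact (planar F).commutes _

/-- The substitution `planar` takes values in the rotation invariant series. -/
theorem rot_planar (c : MvPowerSeries (Fin 2) F) : rot F (planar F c) = 0 := by
  refine eq_zero_of_forall_mem_orderIdeal fun N => ?_
  induction N generalizing c with
  | zero => exact mem_orderIdeal_zero _
  | succ N ih =>
    obtain ⟨c₁, c₂, -, h⟩ := exists_planar_eq c
    have h0 : rot F (C (constantCoeff c)) = 0 := (rot F).map_algebraMap _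
    rw [h, map_add, h0, zero_add, map_add, Derivation.leibniz, Derivation.leibniz, rot_X_zero,
      rot_rhoSq, smul_zero, smul_zero, add_zero, add_zero, smul_eq_mul, smul_eq_mul]
    refine add_mem ?_ ?_
    · rw [add_comm N]
      exact mul_mem_orderIdeal (X_mem_orderIdeal 0) (ih c₁)
    · refine orderIdeal_anti (by omega : N + 1 ≤ 2 + N) ?_
      exact mul_mem_orderIdeal rhoSq_mem_orderIdeal (ih c₂)

/-- The exponent of `x ^ l * w ^ k` in two variables. -/
def expo₂ (l k : ℕ) : Fin 2 →₀ ℕ := Finsupp.single 0 l + Finsupp.single 1 k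

@[simp] theorem expo₂_zero (l k : ℕ) : expo₂ l k 0 = l := by simp [expo₂]
@[simp] theorem expo₂_one (l k : ℕ) : expo₂ l k 1 = k := by simp [expo₂]

theorem expo₂_add_single_zero (l k : ℕ) :
    expo₂ l k + Finsupp.single 0 1 = expo₂ (l + 1) k := by
  ext i
  fin_cases i <;> simp

theorem expo₂_add_single_one (l k : ℕ) :
    expo₂ l k + Finsupp.single 1 1 = expo₂ l (k + 1) := by
  ext i
  fin_cases i <;> simp

theorem coeff_planar (l k : ℕ) (c : MvPowerSeries (Fin 2) F) :
    coeff (expo l (2 * k) 0) (planar F c) = coeff (expo₂ l k) c := by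
  induction h : l + k using Nat.strong_induction_on generalizing l k c with
  | _ m ih =>
    obtain ⟨c₁, c₂, h2, h3⟩ := exists_planar_eq c
    have e1 : coeff (expo l (2 * k) 0) (C (constantCoeff c) : PS F) =
        coeff (expo₂ l k) (C (constantCoeff c) : MvPowerSeries (Fin 2) F) := by
      classical
      rw [coeff_C, coeff_C]
      congr 1
      rw [eq_iff_iff]
      constructor <;> intro h0
      · have h00 := DFunLike.congr_fun h0 0
        have h01 := DFunLike.congr_fun h0 1
        simp at h00 h01
        subst h00 h01
        simp [expo₂]
      · have h00 := DFunLike.congr_fun h0 0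
        have h01 := DFunLike.congr_fun h0 1
        simp at h00 h01
        subst h00 h01
        simp [expo]
    have e2 : coeff (expo l (2 * k) 0) (X 0 * planar F c₁) =
        coeff (expo₂ l k) (X 0 * c₁) := by
      cases l with
      | zero => rw [coeff_expo_zero_X_zero_mul, coeff_X_mul_of_eq_zero (by simp)]
      | succ l =>
        rw [coeff_expo_succ_X_zero_mul, ← expo₂_add_single_zero, coeff_add_single_X_mul,
          ih (l + k) (by omega) l k c₁ rfl]
    have e3 : coeff (expo l (2 * k) 0) (rhoSq F * planar F c₂) =
        coeff (expo₂ l k) (X 1 * c₂) := by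
      cases k with
      | zero => rw [mul_zero, coeff_expo_zero_rhoSq_mul, coeff_X_mul_of_eq_zero (by simp)]
      | succ k =>
        rw [mul_add, mul_one, coeff_expo_rhoSq_mul, ← expo₂_add_single_one,
          coeff_add_single_X_mul, ih (l + k) (by omega) l k c₂ rfl]
    rw [h3, map_add, map_add, e1, e2, e3, ← map_add, ← map_add, ← h2]

theorem constantCoeff_planar (c : MvPowerSeries (Fin 2) F) :
    constantCoeff (planar F c) = constantCoeff c := by
  have h := coeff_planar (F := F) 0 0 c
  have e1 : expo 0 (2 * 0) 0 = 0 := by simp [expo]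
  have e2 : expo₂ 0 0 = 0 := by simp [expo₂]
  rwa [e1, e2] at h

/-- The series in `y ^ 2 + z ^ 2` alone. -/
def radial (F : Type*) [Field F] : PowerSeries F →ₐ[F] PS F :=
  (planar F).comp (PowerSeries.substAlgHom (PowerSeries.HasSubst.X (1 : Fin 2)))

theorem coeff_radial (l k : ℕ) (p : PowerSeries F) :
    coeff (expo l (2 * k) 0) (radial F p) = if l = 0 then PowerSeries.coeff k p else 0 := by
  rw [radial, AlgHom.comp_apply, coeff_planar, PowerSeries.coe_substAlgHom,
    PowerSeries.coeff_subst_single, expo₂_one]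
  congr 1
  rw [eq_iff_iff]
  constructor <;> intro h
  · simpa using DFunLike.congr_fun h 0
  · simp [expo₂, h]

theorem rot_radial (p : PowerSeries F) : rot F (radial F p) = 0 := rot_planar _

theorem radial_X : radial F PowerSeries.X = rhoSq F := by
  rw [radial, AlgHom.comp_apply, PowerSeries.substAlgHom_X, planar_X_one]

variable [CharZero F]

theorem coeff_expo_odd_of_rot {q : PS F} (h : rot F q = 0) (l k b : ℕ) :
    coeff (expo l (2 * k + 1) b) q = 0 := by
  induction k generalizing b with
  | zero => exact coeff_expo_one_of_rot h l b
  | succ k ih =>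
    have h1 := coeff_expo_rot_relation h l (2 * k + 1) b
    rw [ih, mul_zero] at h1
    exact (mul_eq_zero.1 h1).resolve_left (Nat.cast_add_one_ne_zero _)

/-- A rotation invariant series is determined by the coefficients of the `x ^ l * y ^ (2 * k)`. -/
theorem eq_zero_of_rot {q : PS F} (h : rot F q = 0)
    (hc : ∀ l k, coeff (expo l (2 * k) 0) q = 0) : q = 0 := by
  have key : ∀ b l k, coeff (expo l (2 * k) b) q = 0 := by
    intro b
    induction b using Nat.twoStepInduction with
    | zero => exact hc
    | one => exact fun l k => coeff_expo_one_of_rot' h l _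
    | more b ih _ =>
      intro l k
      have h1 := coeff_expo_rot_relation h l (2 * k) b
      rw [show 2 * k + 2 = 2 * (k + 1) by ring, ih, mul_zero] at h1
      exact (mul_eq_zero.1 h1.symm).resolve_left (Nat.cast_add_one_ne_zero _)
  ext d
  rw [← expo_apply d, MvPowerSeries.coeff_zero]
  rcases Nat.even_or_odd' (d 1) with ⟨k, hk | hk⟩
  · rw [hk, key]
  · rw [hk, coeff_expo_odd_of_rot h]

theorem eq_of_rot {p q : PS F} (hp : rot F p = 0) (hq : rot F q = 0)
    (hc : ∀ l k, coeff (expo l (2 * k) 0) p = coeff (expo l (2 * k) 0) q) : p = q :=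
  sub_eq_zero.1 (eq_zero_of_rot (by rw [map_sub, hp, hq, sub_zero]) fun l k => by
    rw [map_sub, hc, sub_self])

/-- Invariance under rotation becomes a linear differential condition, which is much easier to carry
through products, flows and inverses than an explicit preimage. The preimage is read off from the
coefficients of the x^l y^(2k). -/
theorem mem_range_planar {q : PS F} : q ∈ Set.range (planar F) ↔ rot F q = 0 := by
  constructor
  · rintro ⟨c, rfl⟩
    exact rot_planar c
  · intro h
    refine ⟨ofCoeff fun d => coeff (expo (d 0) (2 * d 1) 0) q, eq_of_rot (rot_planar _) h ?_⟩
    intro l k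
    rw [coeff_planar, coeff_ofCoeff, expo₂_zero, expo₂_one]

theorem mem_timeSpace {T : PS F} : T ∈ timeSpace F ↔ rot F T = 0 ∧ constantCoeff T = 0 := by
  rw [timeSpace, Submodule.mem_map]
  constructor
  · rintro ⟨c, hc, rfl⟩
    exact ⟨rot_planar c, (constantCoeff_planar c).trans hc⟩
  · rintro ⟨h1, h2⟩
    obtain ⟨c, rfl⟩ := mem_range_planar.2 h1
    exact ⟨c, (constantCoeff_planar c).symm.trans h2, rfl⟩

theorem mem_eulerSpace {S : VF F} :
    S ∈ eulerSpace F ↔ ∃ g : PS F, rot F g = 0 ∧ constantCoeff g = 0 ∧ S = g • euler F := by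
  rw [eulerSpace, Submodule.mem_map]
  constructor
  · rintro ⟨g, hg, rfl⟩
    exact ⟨g, (mem_timeSpace.1 hg).1, (mem_timeSpace.1 hg).2, rfl⟩
  · rintro ⟨g, h1, h2, rfl⟩
    exact ⟨g, mem_timeSpace.2 ⟨h1, h2⟩, rfl⟩

theorem pderiv_radial (p : PowerSeries F) : pderiv F 0 (radial F p) = 0 := by
  refine eq_zero_of_rot (by rw [← pderiv_rot_comm, rot_radial, map_zero]) fun l k => ?_
  rw [coeff_pderiv, expo_add_single_zero, coeff_radial, if_neg (Nat.succ_ne_zero l), zero_mul]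

theorem exists_radial_eq {q : PS F} (h : rot F q = 0) (h' : pderiv F 0 q = 0) :
    ∃ p, radial F p = q := by
  refine ⟨PowerSeries.mk fun k => coeff (expo 0 (2 * k) 0) q, eq_of_rot (rot_radial _) h ?_⟩
  intro l k
  rw [coeff_radial]
  cases l with
  | zero => simp
  | succ l =>
    have h1 := congrArg (coeff (expo l (2 * k) 0)) h'
    rw [coeff_pderiv, expo_add_single_zero, MvPowerSeries.coeff_zero] at h1
    rw [if_neg (Nat.succ_ne_zero l)]
    exact ((mul_eq_zero.1 h1).resolve_right (Nat.cast_add_one_ne_zero _)).symm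

end RotationInvariants

/-! ### The shape of permissible transformations. -/

section PermissibleTransformations

variable {F : Type*} [Field F]

theorem X_ne_zero' (i : Fin 3) : (X i : PS F) ≠ 0 := by
  intro h
  have := congrArg (coeff (Finsupp.single i 1)) h
  rw [coeff_index_single_self_X, MvPowerSeries.coeff_zero] at this
  exact one_ne_zero this

theorem rhoSq_ne_zero : rhoSq F ≠ 0 := by
  intro h
  have h1 := coeff_expo_rhoSq_mul (F := F) 0 0 1
  have e : expo 0 0 0 = 0 := by simp [expo]
  rw [h, zero_mul, MvPowerSeries.coeff_zero, e, coeff_zero_one] at h1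
  exact zero_ne_one h1

theorem rot_eq_zero_of_mul {a b : PS F} (ha : rot F a = 0) (ha' : a ≠ 0)
    (h : rot F (a * b) = 0) : rot F b = 0 := by
  rw [Derivation.leibniz, ha, smul_zero, add_zero, smul_eq_mul] at h
  exact (mul_eq_zero.1 h).resolve_left ha'

theorem rot_mul {a b : PS F} (ha : rot F a = 0) (hb : rot F b = 0) : rot F (a * b) = 0 := by
  rw [Derivation.leibniz, ha, hb, smul_zero, smul_zero, add_zero]

theorem rot_pow {a : PS F} (ha : rot F a = 0) (n : ℕ) : rot F (a ^ n) = 0 := by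
  rw [Derivation.leibniz_pow, ha, smul_zero, smul_zero]

theorem constantCoeff_euler (q : PS F) : constantCoeff (euler F q) = 0 := by
  rw [← coeff_zero_eq_constantCoeff_apply, coeff_euler]
  simp

/-- The automorphism `φ` is rotation equivariant, tangent to the identity and preserves the
orbits of the weighted scalings. -/
def IsEquivariantScaling (φ : PS F ≃ₐ[F] PS F) : Prop :=
  (∀ q, φ (rot F q) = rot F (φ q)) ∧ ∃ G : PS F, constantCoeff G = 1 ∧
    φ (X 0) = G ^ 2 * X 0 ∧ φ (X 1) = G * X 1 ∧ φ (X 2) = G * X 2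

/-- Apply φ to Θ⁰₀ y = z: this gives G z = G z + y Θ⁰₀(G). -/
theorem IsEquivariantScaling.rot_factor {φ : PS F ≃ₐ[F] PS F} (h : ∀ q, φ (rot F q) = rot F (φ q))
    {G : PS F} (h1 : φ (X 1) = G * X 1) (h2 : φ (X 2) = G * X 2) : rot F G = 0 := by
  have h3 := h (X 1)
  rw [rot_X_one, h1, h2, Derivation.leibniz, rot_X_one, smul_eq_mul, smul_eq_mul,
    left_eq_add] at h3
  exact (mul_eq_zero.1 h3).resolve_left (X_ne_zero' 1)

theorem isEquivariantScaling_one : IsEquivariantScaling (1 : PS F ≃ₐ[F] PS F) :=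
  ⟨fun _ => rfl, 1, by simp, by simp, by simp, by simp⟩

theorem IsEquivariantScaling.mul {φ ψ : PS F ≃ₐ[F] PS F} (hφ : IsEquivariantScaling φ)
    (hψ : IsEquivariantScaling ψ) : IsEquivariantScaling (φ * ψ) := by
  obtain ⟨hr, G, h, h0, h1, h2⟩ := hφ
  obtain ⟨hr', G', h', h0', h1', h2'⟩ := hψ
  refine ⟨fun q => ?_, φ G' * G, ?_, ?_, ?_, ?_⟩
  · rw [AlgEquiv.mul_apply, AlgEquiv.mul_apply, hr', hr]
  · rw [map_mul, algEquiv_constantCoeff, h, h', one_mul]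
  · rw [AlgEquiv.mul_apply, h0', map_mul, map_pow, h0]
    ring
  · rw [AlgEquiv.mul_apply, h1', map_mul, h1, mul_assoc]
  · rw [AlgEquiv.mul_apply, h2', map_mul, h2, mul_assoc]

theorem IsEquivariantScaling.inv {φ : PS F ≃ₐ[F] PS F} (hφ : IsEquivariantScaling φ) :
    IsEquivariantScaling φ⁻¹ := by
  obtain ⟨hr, G, h, h0, h1, h2⟩ := hφ
  have hc : constantCoeff (φ.symm G) = 1 := by rw [algEquiv_constantCoeff, h]
  have hm : (φ.symm G)⁻¹ * φ.symm G = 1 :=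
    MvPowerSeries.inv_mul_cancel _ (by rw [hc]; exact one_ne_zero)
  refine ⟨fun q => ?_, (φ.symm G)⁻¹, ?_, ?_, ?_, ?_⟩
  · change φ.symm (rot F q) = rot F (φ.symm q)
    rw [AlgEquiv.symm_apply_eq, hr, AlgEquiv.apply_symm_apply]
  · rw [constantCoeff_inv, hc, inv_one]
  · change φ.symm (X 0) = _
    have e : X 0 = φ.symm G ^ 2 * φ.symm (X 0) := by
      rw [← map_pow, ← map_mul, ← h0, AlgEquiv.symm_apply_apply]
    conv_rhs => rw [e]
    linear_combination (-((φ.symm G)⁻¹ * φ.symm G) - 1) * φ.symm (X 0) * hm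
  · change φ.symm (X 1) = _
    have e : X 1 = φ.symm G * φ.symm (X 1) := by
      rw [← map_mul, ← h1, AlgEquiv.symm_apply_apply]
    conv_rhs => rw [e]
    rw [← mul_assoc, hm, one_mul]
  · change φ.symm (X 2) = _
    have e : X 2 = φ.symm G * φ.symm (X 2) := by
      rw [← map_mul, ← h2, AlgEquiv.symm_apply_apply]
    conv_rhs => rw [e]
    rw [← mul_assoc, hm, one_mul]

theorem rot_raises_zero {N : ℕ} {q : PS F} (hq : q ∈ orderIdeal F 3 N) :
    rot F q ∈ orderIdeal F 3 N := by
  cases N with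
  | zero => exact mem_orderIdeal_zero _
  | succ N =>
    have hp : ∀ i, pderiv F i q ∈ orderIdeal F 3 N := fun i d hd => by
      rw [coeff_pderiv, hq _ (by simpa using hd), zero_mul]
    rw [rot_apply, add_comm N]
    exact sub_mem (mul_mem_orderIdeal (X_mem_orderIdeal 2) (hp 1))
      (mul_mem_orderIdeal (X_mem_orderIdeal 1) (hp 2))

theorem smul_euler_apply (g q : PS F) : (g • euler F) q = g * euler F q := rfl

theorem raisesOrder_one_smul_euler {g : PS F} (hg : constantCoeff g = 0) :
    RaisesOrder (g • euler F).toLinearMap 1 :=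
  raisesOrder_smul_euler (mem_orderIdeal_one.2 hg)

/-- The factor by which the exponential of `g E` multiplies an eigenvector of `g E`. -/
def expFactor (g l : PS F) : PS F :=
  expOp ((g • euler F).toLinearMap + LinearMap.mulLeft F l) 1

theorem constantCoeff_expFactor {g l : PS F} (hg : constantCoeff g = 0)
    (hl : constantCoeff l = 0) : constantCoeff (expFactor g l) = 1 := by
  rw [expFactor, constantCoeff_expOp (raisesOrder_add_mulLeft (raisesOrder_one_smul_euler hg) hl),
    constantCoeff_one]

theorem IsExp.apply_eigen {g : PS F} {φ : PS F ≃ₐ[F] PS F} (hφ : IsExp (g • euler F) φ)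
    (hg : constantCoeff g = 0) {a l : PS F} (hl : constantCoeff l = 0)
    (h : g * euler F a = l * a) : φ a = expFactor g l * a := by
  rw [isExp_iff.1 hφ, expOp_eigen (raisesOrder_one_smul_euler hg) hl h, expFactor]

theorem IsExp.rot_comm {g : PS F} {φ : PS F ≃ₐ[F] PS F} (hφ : IsExp (g • euler F) φ)
    (hr : rot F g = 0) (hg : constantCoeff g = 0) (q : PS F) : φ (rot F q) = rot F (φ q) := by
  have hR := raisesOrder_one_smul_euler hg
  rw [isExp_iff.1 hφ, isExp_iff.1 hφ]
  refine (map_expOp (T := (rot F).toLinearMap) hR hR 0 (fun N q hq => rot_raises_zero hq) ?_ q).symm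
  intro q
  change rot F (g * euler F q) = g * euler F (rot F q)
  rw [Derivation.leibniz, hr, smul_zero, add_zero, euler_rot_comm, smul_eq_mul]

theorem IsExp.apply_X_zero {g : PS F} {φ : PS F ≃ₐ[F] PS F} (hφ : IsExp (g • euler F) φ)
    (hg : constantCoeff g = 0) : φ (X 0) = expFactor g g * X 0 :=
  hφ.apply_eigen hg hg (by rw [euler_X_zero])

theorem transport_apply (φ : PS F ≃ₐ[F] PS F) (v : VF F) (q : PS F) :
    transport φ v q = φ (v (φ.symm q)) := rfl

theorem transport_smul (φ : PS F ≃ₐ[F] PS F) (f : PS F) (v : VF F) :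
    transport φ (f • v) = φ f • transport φ v := by
  ext1 q
  rw [transport_apply, Derivation.smul_apply, Derivation.smul_apply, transport_apply, smul_eq_mul,
    smul_eq_mul, map_mul]

theorem smul_def' (g : OrbitalTransformation F) (v : VF F) :
    g • v = (g.left : PS F) • transport g.right v := rfl

variable [CharZero F]

@[simp]
theorem euler_rhoSq : euler F (rhoSq F) = rhoSq F := by
  have h2 : (2⁻¹ : F) + 2⁻¹ = 1 := by rw [← two_mul, mul_inv_cancel₀ two_ne_zero]
  simp only [rhoSq, pow_two, map_add, Derivation.leibniz, euler_X_one, euler_X_two, smul_eq_mul,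
    mul_smul_comm, ← add_smul, h2, one_smul]

theorem IsExp.apply_rhoSq {g : PS F} {φ : PS F ≃ₐ[F] PS F} (hφ : IsExp (g • euler F) φ)
    (hg : constantCoeff g = 0) : φ (rhoSq F) = expFactor g g * rhoSq F :=
  hφ.apply_eigen hg hg (by rw [euler_rhoSq])

theorem IsExp.isEquivariantScaling {g : PS F} {φ : PS F ≃ₐ[F] PS F} (hφ : IsExp (g • euler F) φ)
    (hr : rot F g = 0) (hg : constantCoeff g = 0) : IsEquivariantScaling φ := by
  have hg2 : constantCoeff ((2⁻¹ : F) • g) = 0 := by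
    rw [← coeff_zero_eq_constantCoeff_apply, coeff_smul, coeff_zero_eq_constantCoeff_apply, hg,
      mul_zero]
  have h1 : φ (X 1) = expFactor g ((2⁻¹ : F) • g) * X 1 :=
    hφ.apply_eigen hg hg2 (by rw [euler_X_one, mul_smul_comm, smul_mul_assoc])
  have h2 : φ (X 2) = expFactor g ((2⁻¹ : F) • g) * X 2 :=
    hφ.apply_eigen hg hg2 (by rw [euler_X_two, mul_smul_comm, smul_mul_assoc])
  refine ⟨hφ.rot_comm hr hg, expFactor g ((2⁻¹ : F) • g), constantCoeff_expFactor hg hg2, ?_,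
    h1, h2⟩
  have h3 := hφ.apply_rhoSq hg
  have h4 : φ (rhoSq F) = expFactor g ((2⁻¹ : F) • g) ^ 2 * rhoSq F := by
    rw [rhoSq, map_add, map_pow, map_pow, h1, h2]
    ring
  -- x and w are eigenvectors with the same eigenvalue g, so they share their factor; on w = y² + z²
  -- this factor is visibly the square of that of y and z.
  rw [hφ.apply_X_zero hg, mul_right_cancel₀ rhoSq_ne_zero (h3.symm.trans h4)]

theorem isEquivariantScaling_of_mem_stateGroup {φ : PS F ≃ₐ[F] PS F} (hφ : φ ∈ stateGroup F) :
    IsEquivariantScaling φ := by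
  induction hφ using Subgroup.closure_induction with
  | mem φ h =>
    obtain ⟨S, hS, h⟩ := h
    obtain ⟨g, hr, hg, rfl⟩ := mem_eulerSpace.1 hS
    exact h.isEquivariantScaling hr hg
  | one => exact isEquivariantScaling_one
  | mul _ _ _ _ h h' => exact h.mul h'
  | inv _ _ h => exact h.inv

/-- A permissible change of variables transports `E` to an invariant multiple of `E`. -/
theorem IsEquivariantScaling.transport_euler {φ : PS F ≃ₐ[F] PS F} (hφ : IsEquivariantScaling φ) :
    ∃ k : PS F, rot F k = 0 ∧ constantCoeff k = 1 ∧ transport φ (euler F) = k • euler F := by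
  obtain ⟨hr', G', h', h0', h1', h2'⟩ := hφ.inv
  obtain ⟨hr, G, h, h0, h1, h2⟩ := hφ
  have hG := IsEquivariantScaling.rot_factor hr h1 h2
  have hG' := IsEquivariantScaling.rot_factor hr' h1' h2'
  have h2ne : (2 : F) ≠ 0 := two_ne_zero
  change φ.symm (X 0) = _ at h0'
  change φ.symm (X 1) = _ at h1'
  change φ.symm (X 2) = _ at h2'
  have hGG : φ G' * G = 1 := by
    refine mul_right_cancel₀ (X_ne_zero' 1) ?_
    rw [mul_assoc, ← h1, ← map_mul, ← h1', AlgEquiv.apply_symm_apply, one_mul]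
  have ht : (2 : PS F) = C 2 := by rw [map_ofNat]
  have hhalf : ∀ p : PS F, (2⁻¹ : F) • (2 * p) = p := fun p => by
    rw [ht, ← smul_eq_C_mul, smul_smul, inv_mul_cancel₀ h2ne, one_smul]
  -- With φ⁻¹ y = G' y one has E (G' y) = (E G' + G'/2) y. Applying φ and dividing by E y = y/2
  -- gives this factor; φ(G') G = 1 makes the x-component agree.
  refine ⟨G * φ (2 * euler F G' + G'), ?_, ?_, ?_⟩
  · refine rot_mul hG ?_
    rw [← hr, map_add, hG', add_zero, ht, ← smul_eq_C_mul, Derivation.map_smul, ← euler_rot_comm,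
      hG', map_zero, smul_zero, map_zero]
  · rw [map_mul, h, algEquiv_constantCoeff, map_add, map_mul, constantCoeff_euler, h']
    ring
  · refine derivation_ext_X fun i => ?_
    rw [transport_apply, Derivation.smul_apply, smul_eq_mul]
    have key : ∀ i : Fin 3, φ.symm (X i) = G' * X i → φ (X i) = G * X i →
        euler F (X i) = (2⁻¹ : F) • (X i : PS F) →
        φ (euler F (φ.symm (X i))) = G * φ (2 * euler F G' + G') * euler F (X i) := by
      intro i e1 e2 e3
      rw [e1, Derivation.leibniz, e3, smul_eq_mul, smul_eq_mul]
      have : G' * (2⁻¹ : F) • X i + X i * euler F G' =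
          (2⁻¹ : F) • ((2 * euler F G' + G') * X i) := by
        rw [add_mul, smul_add, mul_assoc, hhalf, mul_smul_comm]
        ring
      rw [this, map_smul, map_mul, e2, mul_smul_comm]
      congr 1
      ring
    fin_cases i
    · change φ (euler F (φ.symm (X 0))) = _ * euler F (X 0)
      rw [h0', Derivation.leibniz, Derivation.leibniz_pow, euler_X_zero]
      simp only [smul_eq_mul, nsmul_eq_mul, map_add, map_mul, map_pow, h0, Nat.cast_ofNat,
        map_ofNat, pow_one, Nat.add_one_sub_one]
      linear_combination (φ G' * G + 2 * G * φ (euler F G')) * X 0 * hGG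
    · exact key 1 h1' h1 euler_X_one
    · exact key 2 h2' h2 euler_X_two

/-- Changes of state variables commute with Θ⁰₀ and therefore preserve the invariant units, so the
generated group is the semidirect product of those units with `stateGroup`. -/
theorem mem_permissibleGroup_iff {g : OrbitalTransformation F} :
    g ∈ permissibleGroup F ↔ rot F (g.left : PS F) = 0 ∧ g.right ∈ stateGroup F := by
  constructor
  · intro h
    induction h using Subgroup.closure_induction with
    | mem g h =>
      rcases h with ⟨φ, hφ, rfl⟩ | ⟨τ, hτ, rfl⟩
      · exact ⟨by simp, by simpa using hφ⟩
      · exact ⟨by simpa using mem_range_planar.1 hτ, by simp⟩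
    | one => exact ⟨by simp, one_mem _⟩
    | mul g h _ _ hg hh =>
      refine ⟨?_, mul_mem hg.2 hh.2⟩
      change rot F ((g.left : PS F) * g.right (h.left : PS F)) = 0
      refine rot_mul hg.1 ?_
      rw [← (isEquivariantScaling_of_mem_stateGroup hg.2).1, hh.1, map_zero]
    | inv g _ hg =>
      refine ⟨?_, inv_mem hg.2⟩
      change rot F (g.right⁻¹ ((g.left⁻¹ : (PS F)ˣ) : PS F)) = 0
      rw [← (isEquivariantScaling_of_mem_stateGroup hg.2).inv.1]
      have : rot F ((g.left⁻¹ : (PS F)ˣ) : PS F) = 0 :=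
        rot_eq_zero_of_mul hg.1 g.left.ne_zero (by simp)
      rw [this, map_zero]
  · rintro ⟨h1, h2⟩
    have e : g = SemidirectProduct.inl g.left * SemidirectProduct.inr g.right :=
      (SemidirectProduct.inl_left_mul_inr_right g).symm
    rw [e]
    exact mul_mem (Subgroup.subset_closure (Or.inr ⟨_, mem_range_planar.2 h1, rfl⟩))
      (Subgroup.subset_closure (Or.inl ⟨_, h2, rfl⟩))

theorem exists_mem_stateGroup_isExp {g : PS F} (hr : rot F g = 0) (hg : constantCoeff g = 0) :
    ∃ φ ∈ stateGroup F, IsExp (g • euler F) φ := by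
  obtain ⟨φ, hφ⟩ := exists_isExp (raisesOrder_one_smul_euler hg)
  exact ⟨φ, Subgroup.subset_closure ⟨_, mem_eulerSpace.2 ⟨g, hr, hg, rfl⟩, hφ⟩, hφ⟩

end PermissibleTransformations

/-! ### Restriction to curves and uniqueness of the normal form. -/

section Uniqueness

variable {F : Type*} [Field F]

theorem hasSubst_curve {p : PowerSeries F} (hp : PowerSeries.constantCoeff p = 0) :
    HasSubst (![p, PowerSeries.X, 0] : Fin 3 → MvPowerSeries Unit F) := by
  apply hasSubst_of_constantCoeff_zero
  intro i
  fin_cases i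
  · exact hp
  · exact PowerSeries.constantCoeff_X
  · exact map_zero _

/-- Restriction of a series to the curve `x = p t`, `y = t`, `z = 0`. -/
def curve {p : PowerSeries F} (hp : PowerSeries.constantCoeff p = 0) : PS F →ₐ[F] PowerSeries F :=
  substAlgHom (hasSubst_curve hp)

variable {p : PowerSeries F} (hp : PowerSeries.constantCoeff p = 0)

theorem curve_X_zero : curve hp (X 0) = p := substAlgHom_X (hasSubst_curve hp) 0
theorem curve_X_one : curve hp (X 1) = PowerSeries.X := substAlgHom_X (hasSubst_curve hp) 1
theorem curve_X_two : curve hp (X 2) = 0 := substAlgHom_X (hasSubst_curve hp) 2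

theorem curve_rhoSq : curve hp (rhoSq F) = PowerSeries.X ^ 2 := by
  rw [rhoSq, map_add, map_pow, map_pow, curve_X_one, curve_X_two, zero_pow two_ne_zero, add_zero]

theorem coeff_single_C (i : Fin 3) (a : F) : coeff (Finsupp.single i 1) (C a : PS F) = 0 := by
  simpa using coeff_add_single_C (m := 1) (n := 0) a i

theorem exists_curve_eq (q : PS F) : ∃ c : Fin 3 → PS F,
    q = C (constantCoeff q) + (X 0 * c 0 + X 1 * c 1 + X 2 * c 2) ∧
      curve hp q = PowerSeries.C (constantCoeff q) +
        (p * curve hp (c 0) + PowerSeries.X * curve hp (c 1)) := by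
  obtain ⟨c, hc⟩ := exists_eq_C_add_sum_X_mul q
  rw [Fin.sum_univ_three] at hc
  refine ⟨c, hc, ?_⟩
  conv_lhs => rw [hc]
  rw [map_add, map_add, map_add, map_mul, map_mul, map_mul, curve_X_zero, curve_X_one, curve_X_two,
    zero_mul, add_zero]
  congr 1
  exact (curve hp).commutes _

theorem constantCoeff_curve (q : PS F) :
    PowerSeries.constantCoeff (curve hp q) = constantCoeff q := by
  obtain ⟨c, -, h⟩ := exists_curve_eq hp q
  rw [h]
  simp [hp]

theorem coeff_one_curve (hp1 : PowerSeries.coeff 1 p = 0) (q : PS F) :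
    PowerSeries.coeff 1 (curve hp q) = coeff (expo 0 1 0) q := by
  obtain ⟨c, hc, h⟩ := exists_curve_eq hp q
  have e0 : expo 0 0 0 = 0 := by simp [expo]
  have h1 : coeff (expo 0 1 0) q = constantCoeff (c 1) := by
    conv_lhs => rw [hc]
    rw [map_add, map_add, map_add, coeff_expo_zero_X_zero_mul, coeff_expo_zero_X_two_mul,
      coeff_expo_succ_X_one_mul, e0, coeff_zero_eq_constantCoeff_apply, ← expo_add_single_one, e0,
      zero_add, coeff_single_C, zero_add, zero_add, add_zero]
  have h2 : PowerSeries.X ^ 2 ∣ p := by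
    rw [PowerSeries.X_pow_dvd_iff]
    intro m hm
    interval_cases m
    · simpa using hp
    · exact hp1
  have h3 : PowerSeries.coeff 1 (p * curve hp (c 0)) = 0 :=
    PowerSeries.X_pow_dvd_iff.1 (Dvd.dvd.mul_right h2 _) 1 one_lt_two
  rw [h, h1, map_add, map_add, h3, PowerSeries.coeff_C, if_neg one_ne_zero, zero_add, zero_add,
    ← zero_add 1, PowerSeries.coeff_succ_X_mul, PowerSeries.coeff_zero_eq_constantCoeff_apply,
    constantCoeff_curve]

/-- On a curve x = p(t), y = t, z = 0 with p of order at least two, only x and y² contribute to t².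
This is used to read off the E-weight-one part of an invariant series on x + b w = 0. -/
theorem coeff_two_curve (hp1 : PowerSeries.coeff 1 p = 0) (q : PS F) :
    PowerSeries.coeff 2 (curve hp q) =
      PowerSeries.coeff 2 p * coeff (expo 1 0 0) q + coeff (expo 0 2 0) q := by
  obtain ⟨c, hc, h⟩ := exists_curve_eq hp q
  have e0 : expo 0 0 0 = 0 := by simp [expo]
  have h1 : coeff (expo 0 2 0) q = coeff (expo 0 1 0) (c 1) := by
    conv_lhs => rw [hc]
    rw [map_add, map_add, map_add, coeff_expo_zero_X_zero_mul, coeff_expo_zero_X_two_mul,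
      coeff_expo_succ_X_one_mul, ← expo_add_single_one 0 1 0]
    simp
  have h1' : coeff (expo 1 0 0) q = constantCoeff (c 0) := by
    conv_lhs => rw [hc]
    rw [map_add, map_add, map_add, coeff_expo_succ_X_zero_mul, coeff_expo_zero_X_two_mul,
      coeff_expo_zero_X_one_mul, e0, coeff_zero_eq_constantCoeff_apply, ← expo_add_single_zero, e0,
      zero_add, coeff_single_C, zero_add, add_zero, add_zero]
  have h2 : PowerSeries.X ^ 2 ∣ p := by
    rw [PowerSeries.X_pow_dvd_iff]
    intro m hm
    interval_cases m
    · simpa using hp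
    · exact hp1
  obtain ⟨p', rfl⟩ := h2
  have e2 : PowerSeries.coeff 2 (PowerSeries.X ^ 2 * p' * curve hp (c 0)) =
      PowerSeries.coeff 2 (PowerSeries.X ^ 2 * p') * constantCoeff (c 0) := by
    rw [mul_assoc]
    have := PowerSeries.coeff_X_pow_mul (p' * curve hp (c 0)) 2 0
    rw [zero_add] at this
    rw [this]
    have := PowerSeries.coeff_X_pow_mul p' 2 0
    rw [zero_add] at this
    rw [this, PowerSeries.coeff_zero_eq_constantCoeff_apply, map_mul, constantCoeff_curve,
      PowerSeries.coeff_zero_eq_constantCoeff_apply]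
  rw [h, map_add, map_add, e2, h1, h1', PowerSeries.coeff_C, if_neg two_ne_zero, zero_add,
    ← coeff_one_curve hp hp1]
  congr 1
  exact PowerSeries.coeff_succ_X_mul 1 _

/-- The series `x + b w + c w ^ r`. -/
def nfSeries (r : ℕ) (b c : F) : PS F := X 0 + b • rhoSq F + c • rhoSq F ^ r

theorem orbitalNF_sub_rot (r : ℕ) (b c : F) :
    orbitalNF r b c - rot F = nfSeries r b c • euler F := by
  rw [orbitalNF, nfSeries, eulerMonomial, eulerMonomial, eulerMonomial, timeMonomial, timeMonomial,
    timeMonomial]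
  simp only [pow_one, Nat.sub_self, pow_zero, mul_one, Nat.sub_zero, one_mul, add_smul, smul_assoc]
  abel

theorem rot_nfSeries (r : ℕ) (b c : F) : rot F (nfSeries r b c) = 0 := by
  rw [nfSeries, map_add, map_add, Derivation.map_smul, Derivation.map_smul, rot_X_zero, rot_rhoSq,
    rot_pow rot_rhoSq, smul_zero, smul_zero, add_zero, add_zero]

theorem constantCoeff_rhoSq : constantCoeff (rhoSq F) = 0 := by
  simp [rhoSq]

theorem constantCoeff_nfSeries {r : ℕ} (hr : r ≠ 0) (b c : F) :
    constantCoeff (nfSeries r b c) = 0 := by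
  simp [nfSeries, smul_eq_C_mul, constantCoeff_rhoSq, hr]

theorem smul_euler_inj {f g : PS F} (h : f • euler F = g • euler F) : f = g := by
  have := DFunLike.congr_fun h (X 0)
  rw [smul_euler_apply, smul_euler_apply, euler_X_zero] at this
  exact mul_right_cancel₀ (X_ne_zero' 0) this

/-- The series of the curve `x + b w + c w ^ r = 0`. -/
def nfCurve (r : ℕ) (b c : F) : PowerSeries F :=
  -(b • PowerSeries.X ^ 2 + c • PowerSeries.X ^ (2 * r))

theorem coeff_nfCurve (r : ℕ) (b c : F) (n : ℕ) : PowerSeries.coeff n (nfCurve r b c) =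
    -(b * (if n = 2 then 1 else 0) + c * (if n = 2 * r then 1 else 0)) := by
  simp [nfCurve, PowerSeries.coeff_X_pow]

theorem constantCoeff_nfCurve {r : ℕ} (hr : r ≠ 0) (b c : F) :
    PowerSeries.constantCoeff (nfCurve r b c) = 0 := by
  rw [← PowerSeries.coeff_zero_eq_constantCoeff_apply, coeff_nfCurve, if_neg (by omega),
    if_neg (by omega)]
  simp

theorem curve_nfSeries {r : ℕ} (hr : r ≠ 0) (b c : F) :
    curve (constantCoeff_nfCurve hr b c) (nfSeries r b c) = 0 := by
  rw [nfSeries, map_add, map_add, map_smul, map_smul, map_pow, curve_X_zero, curve_rhoSq, nfCurve,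
    ← pow_mul]
  ring

/-- On the curve x + b w + c w^r = 0, where w = t², the left side vanishes and the unit U cancels,
leaving b' t² + c' t^(2r') k = b t² + c t^(2r) with k(0) = 1. The conclusion compares the series and
not the exponents, because r is undetermined when c = 0. -/
theorem nfSeries_unique {r r' : ℕ} (hr : 2 ≤ r) (hr' : 2 ≤ r') {b c b' c' : F} {U H : PS F}
    (hU : constantCoeff U ≠ 0) (hH : constantCoeff H = 1)
    (h : nfSeries r b c =
      U * (X 0 + b' • rhoSq F + c' • (rhoSq F ^ r' * H ^ (r' - 1)))) :
    nfSeries r' b' c' = nfSeries r b c := by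
  have hr0 : r ≠ 0 := by omega
  set χ := curve (constantCoeff_nfCurve hr0 b c) with hχ
  set k := χ H ^ (r' - 1) with hk
  have hk0 : PowerSeries.coeff 0 k = 1 := by
    rw [PowerSeries.coeff_zero_eq_constantCoeff_apply, hk, map_pow, hχ, constantCoeff_curve, hH,
      one_pow]
  have h1 := congrArg χ h
  have hU' : χ U ≠ 0 := by
    intro h0
    have := constantCoeff_curve (constantCoeff_nfCurve hr0 b c) U
    rw [← hχ, h0, map_zero] at this
    exact hU this.symm
  rw [hχ, curve_nfSeries hr0, ← hχ, map_mul] at h1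
  have h2 := (mul_eq_zero.1 h1.symm).resolve_left hU'
  rw [map_add, map_add, map_smul, map_smul, map_mul, map_pow, map_pow, hχ, curve_X_zero,
    curve_rhoSq, ← hχ, ← hk, ← pow_mul] at h2
  have h3 : ∀ n, -(b * (if n = 2 then 1 else 0) + c * (if n = 2 * r then 1 else 0)) +
      b' * (if n = 2 then 1 else 0) + c' * PowerSeries.coeff n (PowerSeries.X ^ (2 * r') * k) =
        0 := by
    intro n
    have := congrArg (PowerSeries.coeff n) h2
    rw [map_add, map_add, coeff_nfCurve, map_zero] at this
    simpa [PowerSeries.coeff_X_pow] using this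
  have hlow : ∀ n < 2 * r', PowerSeries.coeff n (PowerSeries.X ^ (2 * r') * k) = 0 :=
    PowerSeries.X_pow_dvd_iff.1 (dvd_mul_right _ _)
  have hb : b' = b := by
    have := h3 2
    rw [hlow 2 (by omega), if_pos rfl, if_neg (by omega)] at this
    linear_combination this
  have hc1 := h3 (2 * r')
  have hc2 := h3 (2 * r)
  have e : PowerSeries.coeff (2 * r') (PowerSeries.X ^ (2 * r') * k) = 1 := by
    have := PowerSeries.coeff_X_pow_mul k (2 * r') 0
    rwa [zero_add, hk0] at this
  rw [e, if_neg (by omega)] at hc1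
  rw [if_neg (by omega), if_pos rfl] at hc2
  subst hb
  by_cases hrr : r' = r
  · subst hrr
    rw [if_pos rfl] at hc1
    have : c' = c := by linear_combination hc1
    rw [this]
  -- For r ≠ r' the coefficient of t^(2r') forces c' = 0, and then that of t^(2r) forces c = 0.
  · rw [if_neg (by omega)] at hc1
    have h4 : c' = 0 := by linear_combination hc1
    rw [h4] at hc2
    have h5 : c = 0 := by linear_combination -hc2
    rw [h4, h5, nfSeries, nfSeries, zero_smul, zero_smul]

theorem IsEquivariantScaling.apply_nfSeries {φ : PS F ≃ₐ[F] PS F} {H : PS F}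
    (h0 : φ (X 0) = H * X 0) (hw : φ (rhoSq F) = H * rhoSq F) {r : ℕ} (hr : r ≠ 0) (b c : F) :
    φ (nfSeries r b c) =
      H * (X 0 + b • rhoSq F + c • (rhoSq F ^ r * H ^ (r - 1))) := by
  obtain ⟨s, rfl⟩ := Nat.exists_eq_succ_of_ne_zero hr
  rw [nfSeries, map_add, map_add, map_smul, map_smul, map_pow, h0, hw, Nat.succ_sub_one,
    pow_succ, pow_succ]
  simp only [smul_eq_C_mul]
  ring

theorem IsEquivariantScaling.exists_scale {φ : PS F ≃ₐ[F] PS F} (hφ : IsEquivariantScaling φ) :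
    ∃ H : PS F, constantCoeff H = 1 ∧ φ (X 0) = H * X 0 ∧ φ (rhoSq F) = H * rhoSq F := by
  obtain ⟨-, G, h, h0, h1, h2⟩ := hφ
  refine ⟨G ^ 2, by rw [map_pow, h, one_pow], h0, ?_⟩
  rw [rhoSq, map_add, map_pow, map_pow, h1, h2]
  ring

variable [CharZero F]

theorem orbitalNF_unique {r r' : ℕ} (hr : 2 ≤ r) (hr' : 2 ≤ r') {b c b' c' : F} {v : VF F}
    (h : OrbitallyEquivalent v (orbitalNF r b c))
    (h' : OrbitallyEquivalent v (orbitalNF r' b' c')) : orbitalNF r' b' c' = orbitalNF r b c := by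
  obtain ⟨g, hg, e⟩ := h
  obtain ⟨g', hg', e'⟩ := h'
  rw [← sub_eq_iff_eq_add', orbitalNF_sub_rot] at e e'
  have hmem := mul_mem hg (inv_mem hg')
  have e2 : nfSeries r b c • euler F = (g * g'⁻¹) • nfSeries r' b' c' • euler F := by
    rw [e, e', mul_smul, inv_smul_smul]
  obtain ⟨-, hs⟩ := mem_permissibleGroup_iff.1 hmem
  have hs := isEquivariantScaling_of_mem_stateGroup hs
  obtain ⟨k, -, hk, hkE⟩ := hs.transport_euler
  obtain ⟨H, hH, h0, hw⟩ := hs.exists_scale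
  rw [smul_def', transport_smul, hkE, IsEquivariantScaling.apply_nfSeries h0 hw (by omega),
      smul_smul, smul_smul] at e2
  have e3 := smul_euler_inj e2
  set τ := (g * g'⁻¹).left
  have hτ : constantCoeff (τ : PS F) ≠ 0 :=
    (isUnit_iff_constantCoeff.1 τ.isUnit).ne_zero
  have e4 : nfSeries r' b' c' = nfSeries r b c := by
    refine nfSeries_unique hr hr' (U := τ * H * k) (H := H) ?_ hH ?_
    · rw [map_mul, map_mul, hH, hk, mul_one, mul_one]
      exact hτ
    · rw [e3]
      ring
  rw [← sub_left_inj (a := rot F), orbitalNF_sub_rot, orbitalNF_sub_rot, e4]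

end Uniqueness

/-! ### Weierstrass preparation and radial flows. -/

section Existence

/-- A recursion in which every value depends only on smaller ones has a solution. -/
theorem exists_fixedPoint_of_wellFounded {ι α : Type*} [Nonempty α] {r : ι → ι → Prop}
    (hr : WellFounded r) (Φ : (ι → α) → ι → α)
    (h : ∀ s t i, (∀ j, r j i → s j = t j) → Φ s i = Φ t i) : ∃ s, Φ s = s := by
  classical
  refine ⟨hr.fix fun i rec => Φ (fun j => if hj : r j i then rec j hj else
    Classical.arbitrary α) i, ?_⟩
  funext i
  conv_rhs => rw [hr.fix_eq]
  refine h _ _ i fun j hj => ?_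
  rw [dif_pos hj]

variable {F : Type*} [Field F]

/-- The lexicographic comparison of exponents in two variables, the second one first. -/
def LexLT (d e : Fin 2 →₀ ℕ) : Prop := d 1 < e 1 ∨ d 1 = e 1 ∧ d 0 < e 0

theorem wellFounded_lexLT : WellFounded LexLT := by
  have h : WellFounded (InvImage (Prod.Lex (α := ℕ) (β := ℕ) (· < ·) (· < ·))
      (fun d : Fin 2 →₀ ℕ => (d 1, d 0))) :=
    InvImage.wf _ (WellFounded.prod_lex wellFounded_lt wellFounded_lt)
  refine Subrelation.wf (fun {d e} hde => ?_) h
  rw [InvImage, Prod.lex_def]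
  exact hde

/-- If p + q = d + (1, 0) and p is not below d, then q has no second component and its first is at
most 1. So q = 0, where f vanishes, or q = (1, 0) and p = d. The coefficient of s f at d + (1, 0) is
thus triangular in the coefficients of s. -/
theorem coeff_mul_of_lexLT {f s : MvPowerSeries (Fin 2) F} (h0 : constantCoeff f = 0)
    {d : Fin 2 →₀ ℕ} (hs : ∀ e, LexLT e d → coeff e s = 0) :
    coeff (d + Finsupp.single 0 1) (s * f) = coeff d s * coeff (Finsupp.single 0 1) f := by
  classical
  rw [coeff_mul, Finset.sum_eq_single (d, Finsupp.single 0 1)]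
  · rintro ⟨p, q⟩ hpq hne
    replace hpq : p + q = d + Finsupp.single 0 1 := Finset.HasAntidiagonal.mem_antidiagonal.1 hpq
    have hp0 := DFunLike.congr_fun hpq 0
    have hp1 := DFunLike.congr_fun hpq 1
    simp only [Finsupp.add_apply, Finsupp.single_eq_same] at hp0 hp1
    rw [Finsupp.single_eq_of_ne (by decide)] at hp1
    change coeff p s * coeff q f = 0
    by_cases hrp : LexLT p d
    · rw [hs p hrp, zero_mul]
    · have hq : q = 0 := by
        rw [LexLT] at hrp
        by_contra hq
        have hq' : q = Finsupp.single 0 1 := by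
          have hq0 : q 0 ≠ 0 := fun hq0 => hq (Finsupp.ext fun i => by
            fin_cases i
            · exact hq0
            · change q 1 = 0
              omega)
          ext i
          fin_cases i
          · change q 0 = (Finsupp.single 0 1 : Fin 2 →₀ ℕ) 0
            rw [Finsupp.single_eq_same]
            omega
          · change q 1 = (Finsupp.single 0 1 : Fin 2 →₀ ℕ) 1
            rw [Finsupp.single_eq_of_ne (by decide)]
            omega
        rw [hq'] at hpq
        exact hne (by rw [hq', add_right_cancel hpq])
      rw [hq, coeff_zero_eq_constantCoeff_apply, h0, mul_zero]
  · intro h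
    exact (h (Finset.HasAntidiagonal.mem_antidiagonal.2 rfl)).elim

/-- Weierstrass preparation for a series that is regular of order one in the first variable. -/
theorem exists_mul_coeff_eq {f : MvPowerSeries (Fin 2) F} (h0 : constantCoeff f = 0)
    (h1 : coeff (Finsupp.single 0 1) f ≠ 0) : ∃ t : MvPowerSeries (Fin 2) F,
      ∀ d, coeff (d + Finsupp.single 0 1) (t * f) = coeff (d + Finsupp.single 0 1) (X 0) := by
  set a := coeff (Finsupp.single 0 1) f
  -- The correction by a⁻¹ times the defect cancels the dependence on s d, so the right side
  -- involves smaller exponents only; its fixed points are exactly the solutions.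
  obtain ⟨s, hs⟩ := exists_fixedPoint_of_wellFounded wellFounded_lexLT
    (fun (s : (Fin 2 →₀ ℕ) → F) d => s d + a⁻¹ * (coeff (d + Finsupp.single 0 1) (X 0) -
      coeff (d + Finsupp.single 0 1) (ofCoeff s * f))) (by
    intro s t d hst
    have h2 := coeff_mul_of_lexLT (s := ofCoeff s - ofCoeff t) h0 fun e (he : LexLT e d) => by
      rw [map_sub, coeff_ofCoeff, coeff_ofCoeff, hst e he, sub_self]
    rw [sub_mul, map_sub, map_sub, coeff_ofCoeff, coeff_ofCoeff] at h2
    change _ = (s d - t d) * a at h2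
    have h4 : a⁻¹ * ((s d - t d) * a) = s d - t d := by field_simp
    linear_combination (-a⁻¹) * h2 - h4)
  refine ⟨ofCoeff s, fun d => ?_⟩
  have h2 := congrFun hs d
  rw [add_eq_left] at h2
  exact (sub_eq_zero.1 ((mul_eq_zero.1 h2).resolve_left (inv_ne_zero h1))).symm

theorem coeff_expo_radial_one (p : PowerSeries F) : coeff (expo 1 0 0) (radial F p) = 0 := by
  have := coeff_radial 1 0 p
  rwa [if_neg one_ne_zero] at this

theorem coeff_expo_X_zero : coeff (expo 1 0 0) (X 0 : PS F) = 1 := by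
  have : expo 1 0 0 = Finsupp.single 0 1 := by simp [expo]
  rw [this, coeff_index_single_self_X]

theorem rhoSq_pow_mem_orderIdeal (m : ℕ) : rhoSq F ^ m ∈ orderIdeal F 3 (2 * m) := by
  induction m with
  | zero => exact mem_orderIdeal_zero _
  | succ m ih =>
    rw [pow_succ, mul_add, mul_one]
    exact mul_mem_orderIdeal ih rhoSq_mem_orderIdeal

/-- The exponential of a radial multiple of `E` maps radial series to radial series. -/
theorem pderiv_expOp_of_pderiv {g q : PS F} (hg : constantCoeff g = 0) (hg' : pderiv F 0 g = 0)
    (hq : pderiv F 0 q = 0) : pderiv F 0 (expOp (g • euler F).toLinearMap q) = 0 := by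
  have hR := raisesOrder_one_smul_euler hg
  have := map_expOp (T := (pderiv F 0).toLinearMap) hR (raisesOrder_add_mulLeft hR hg) 1
    (fun N q hq d hd => by
      change coeff d (pderiv F 0 q) = 0
      rw [coeff_pderiv, hq _ (by simpa using hd), zero_mul])
    (fun q => by
      change pderiv F 0 (g * euler F q) =
        g * euler F (pderiv F 0 q) + g * pderiv F 0 q
      rw [Derivation.leibniz, hg', pderiv_euler, smul_zero, add_zero, smul_eq_mul, mul_add]) q
  change pderiv F 0 (expOp (g • euler F).toLinearMap q) = _ at this
  rw [this]
  change expOp _ (pderiv F 0 q) = 0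
  rw [hq]
  simpa using expOp_sub (L := (g • euler F).toLinearMap + LinearMap.mulLeft F g) (0 : PS F) 0

theorem constantCoeff_rhoSq_mul (q : PS F) : constantCoeff (rhoSq F * q) = 0 := by
  rw [map_mul, constantCoeff_rhoSq, zero_mul]

variable [CharZero F]

theorem exists_mul_eq_X_add_radial {f : PS F} (hr : rot F f = 0) (h0 : constantCoeff f = 0)
    (h1 : coeff (expo 1 0 0) f ≠ 0) : ∃ (T : PS F) (p : PowerSeries F), rot F T = 0 ∧
      constantCoeff T ≠ 0 ∧ PowerSeries.constantCoeff p = 0 ∧ T * f = X 0 + radial F p := by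
  obtain ⟨c, rfl⟩ := mem_range_planar.2 hr
  have h1' := h1
  rw [show expo 1 0 0 = expo 1 (2 * 0) 0 from rfl, coeff_planar] at h1'
  obtain ⟨t, ht⟩ := exists_mul_coeff_eq (f := c) (by rwa [← constantCoeff_planar])
    (by simpa [expo₂] using h1')
  have e : planar F (t * c - X 0) = planar F t * planar F c - X 0 := by
    rw [map_sub, map_mul, planar_X_zero]
  obtain ⟨p, hp⟩ := exists_radial_eq (rot_planar (t * c - X 0)) (by
    refine eq_zero_of_rot (by rw [← pderiv_rot_comm, rot_planar, map_zero]) fun l k => ?_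
    rw [coeff_pderiv, expo_add_single_zero, coeff_planar, ← expo₂_add_single_zero, map_sub, ht,
      sub_self, zero_mul])
  rw [e] at hp
  have hT : planar F t * planar F c = X 0 + radial F p := by rw [hp]; ring
  refine ⟨planar F t, p, rot_planar t, fun hT0 => ?_, ?_, hT⟩
  -- If T had no constant term, T f would have order at least two and could not contain x.
  · have h2 := mul_mem_orderIdeal (mem_orderIdeal_one.2 hT0) (mem_orderIdeal_one.2 h0)
    rw [hT] at h2
    have h3 := h2 (expo 1 0 0) (by simp)
    rw [map_add, coeff_expo_radial_one, coeff_expo_X_zero, add_zero] at h3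
    exact one_ne_zero h3
  · have h2 := congrArg constantCoeff hp
    rw [map_sub, map_mul, h0, mul_zero, constantCoeff_X, sub_zero] at h2
    have h3 := coeff_radial (F := F) 0 0 p
    have e0 : expo 0 (2 * 0) 0 = 0 := by simp [expo]
    rw [if_pos rfl, e0, coeff_zero_eq_constantCoeff_apply, h2] at h3
    rw [← PowerSeries.coeff_zero_eq_constantCoeff_apply, ← h3]

theorem euler_rhoSq_pow (m : ℕ) : euler F (rhoSq F ^ m) = (m : PS F) * rhoSq F ^ m := by
  cases m with
  | zero => simp
  | succ m =>
    rw [Derivation.leibniz_pow, euler_rhoSq, Nat.add_sub_cancel, smul_eq_mul, nsmul_eq_mul,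
      ← pow_succ]

/-- The leading coefficient of the dependence of `exp (w γ(w) E) (w ^ m)` on `γ`. -/
theorem coeff_expOp_radial_sub {m n : ℕ} {s t : PowerSeries F}
    (h : ∀ j < n, PowerSeries.coeff j s = PowerSeries.coeff j t) :
    coeff (expo 0 (2 * (m + 1 + n)) 0)
        (expOp ((rhoSq F * radial F s) • euler F).toLinearMap (rhoSq F ^ m)) -
      coeff (expo 0 (2 * (m + 1 + n)) 0)
        (expOp ((rhoSq F * radial F t) • euler F).toLinearMap (rhoSq F ^ m)) =
      m * (PowerSeries.coeff n s - PowerSeries.coeff n t) := by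
  obtain ⟨δ, hδ⟩ : PowerSeries.X ^ n ∣ s - t := PowerSeries.X_pow_dvd_iff.2 fun j hj => by
    rw [map_sub, h j hj, sub_self]
  have hδ0 : PowerSeries.coeff n s - PowerSeries.coeff n t = PowerSeries.coeff 0 δ := by
    rw [← map_sub, hδ]
    simpa using PowerSeries.coeff_X_pow_mul δ n 0
  have hdiff : rhoSq F * radial F s - rhoSq F * radial F t =
      rhoSq F ^ (n + 1) * radial F δ := by
    rw [← mul_sub, ← map_sub, hδ, map_mul, map_pow, radial_X]
    ring
  have hsub : ((rhoSq F * radial F s) • euler F).toLinearMap -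
      ((rhoSq F * radial F t) • euler F).toLinearMap =
      ((rhoSq F ^ (n + 1) * radial F δ) • euler F).toLinearMap := by
    rw [← hdiff]
    ext1 q
    exact (sub_mul _ _ _).symm
  have hraise : RaisesOrder (((rhoSq F * radial F s) • euler F).toLinearMap -
      ((rhoSq F * radial F t) • euler F).toLinearMap) (2 * (n + 1)) := by
    rw [hsub]
    exact raisesOrder_smul_euler (Ideal.mul_mem_right _ _ (rhoSq_pow_mem_orderIdeal _))
  -- In lowest order the two exponentials differ by the difference of the generators applied to w^m,
  -- that is by m w^(m+n+1) δ.
  have h1 := expOp_sub_expOp_sub_mem (raisesOrder_one_smul_euler (constantCoeff_rhoSq_mul _))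
    (raisesOrder_one_smul_euler (constantCoeff_rhoSq_mul _)) hraise (rhoSq_pow_mem_orderIdeal m)
    (expo 0 (2 * (m + 1 + n)) 0) (by rw [degree_expo]; omega)
  rw [← LinearMap.sub_apply, hsub, map_sub, map_sub, sub_eq_zero] at h1
  rw [h1]
  change coeff _ (rhoSq F ^ (n + 1) * radial F δ * euler F (rhoSq F ^ m)) = _
  have e : rhoSq F ^ (n + 1) * radial F δ * euler F (rhoSq F ^ m) =
      (m : F) • radial F (PowerSeries.X ^ (m + 1 + n) * δ) := by
    rw [euler_rhoSq_pow, map_mul, map_pow, radial_X, smul_eq_C_mul, map_natCast]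
    ring
  have e2 := PowerSeries.coeff_X_pow_mul δ (m + 1 + n) 0
  rw [zero_add] at e2
  rw [e, coeff_smul, coeff_radial, if_pos rfl, e2, hδ0]

/-- Every `w ^ m * u(w)` with `u(0) = 1` is the image of `w ^ m` under a radial flow. -/
theorem exists_flow_rhoSq_pow {m : ℕ} (hm : m ≠ 0) {u : PowerSeries F}
    (hu : PowerSeries.constantCoeff u = 1) : ∃ g : PS F, rot F g = 0 ∧ constantCoeff g = 0 ∧
      ∀ φ : PS F ≃ₐ[F] PS F, IsExp (g • euler F) φ →
        φ (rhoSq F ^ m) = radial F u * rhoSq F ^ m := by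
  have hm' : (m : F) ≠ 0 := Nat.cast_ne_zero.2 hm
  -- The n-th coefficient of the generator w s(w) E first enters at w^(m+1+n), with factor m ≠ 0,
  -- and so can be solved for recursively.
  obtain ⟨s, hs⟩ := exists_fixedPoint_of_wellFounded (wellFounded_lt (α := ℕ))
    (fun (s : ℕ → F) n => s n + (m : F)⁻¹ * (PowerSeries.coeff (n + 1) u -
      coeff (expo 0 (2 * (m + 1 + n)) 0)
        (expOp ((rhoSq F * radial F (PowerSeries.mk s)) • euler F).toLinearMap (rhoSq F ^ m)))) (by
    intro s t n hst
    have h1 := coeff_expOp_radial_sub (m := m) (n := n) (s := PowerSeries.mk s)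
      (t := PowerSeries.mk t) (fun j hj => by simpa using hst j hj)
    rw [PowerSeries.coeff_mk, PowerSeries.coeff_mk] at h1
    have h4 : (m : F)⁻¹ * (m * (s n - t n)) = s n - t n := by field_simp
    linear_combination (-(m : F)⁻¹) * h1 - h4)
  set g := rhoSq F * radial F (PowerSeries.mk s) with hg
  have hg0 : constantCoeff g = 0 := constantCoeff_rhoSq_mul _
  have hgr : rot F g = 0 := rot_mul rot_rhoSq (rot_radial _)
  refine ⟨g, hgr, hg0, fun φ hφ => ?_⟩
  have hmg : constantCoeff ((m : PS F) * g) = 0 := by rw [map_mul, hg0, mul_zero]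
  have h1 := hφ.apply_eigen hg0 (a := rhoSq F ^ m) hmg (by rw [euler_rhoSq_pow]; ring)
  set U := expFactor g (m * g)
  have hU1 : constantCoeff U = 1 := constantCoeff_expFactor hg0 hmg
  have hUr : rot F U = 0 := by
    refine rot_eq_zero_of_mul (rot_pow rot_rhoSq m) (pow_ne_zero m rhoSq_ne_zero) ?_
    rw [mul_comm, ← h1, ← hφ.rot_comm hgr hg0, rot_pow rot_rhoSq, map_zero]
  have hpw : pderiv F 0 (rhoSq F ^ m) = 0 := by
    rw [Derivation.leibniz_pow, pderiv_zero_rhoSq, smul_zero, smul_zero]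
  have hUp : pderiv F 0 U = 0 := by
    have hgp : pderiv F 0 g = 0 := by
      rw [hg, Derivation.leibniz, pderiv_radial, pderiv_zero_rhoSq, smul_zero, smul_zero, add_zero]
    have h2 := pderiv_expOp_of_pderiv hg0 hgp hpw
    rw [← isExp_iff.1 hφ, h1, Derivation.leibniz, hpw, smul_zero, zero_add, smul_eq_mul] at h2
    exact (mul_eq_zero.1 h2).resolve_left (pow_ne_zero m rhoSq_ne_zero)
  obtain ⟨u', hu'⟩ := exists_radial_eq hUr hUp
  have : u' = u := by
    ext n
    cases n with
    | zero =>
      have h3 := coeff_radial (F := F) 0 0 u'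
      have e0 : expo 0 (2 * 0) 0 = 0 := by simp [expo]
      rw [hu', e0, coeff_zero_eq_constantCoeff_apply, hU1, if_pos rfl] at h3
      rw [← h3, PowerSeries.coeff_zero_eq_constantCoeff_apply, hu]
    | succ n =>
      have h2 := congrFun hs n
      rw [add_eq_left, ← isExp_iff.1 hφ, h1, ← hu'] at h2
      have h3 := sub_eq_zero.1 ((mul_eq_zero.1 h2).resolve_left (inv_ne_zero hm'))
      rw [h3]
      have e : radial F u' * rhoSq F ^ m = radial F (PowerSeries.X ^ m * u') := by
        rw [map_mul, map_pow, radial_X, mul_comm]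
      rw [e, coeff_radial, if_pos rfl, show m + 1 + n = n + 1 + m by ring,
        PowerSeries.coeff_X_pow_mul]
  rw [h1, ← hu', this]

end Existence

/-! ### Reduction to the normal form, the style, and infinite level. -/

section NormalForm

variable {F : Type*} [Field F]

/-- Invariance excludes y and z from f. Without x, then, f has order at least two, the components of
f E have order at least three, and Θ⁰₀ is linear, so nothing quadratic is left. -/
theorem coeff_expo_one_ne_zero_of_quadraticPart {v : VF F} {f : PS F} (hr : rot F f = 0)
    (h0 : constantCoeff f = 0) (hf : v - rot F = f • euler F) (hq : HasNonzeroQuadraticPart v) :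
    coeff (expo 1 0 0) f ≠ 0 := by
  intro h1
  have hf2 : f ∈ orderIdeal F 3 2 := by
    intro d hd
    rw [← expo_apply d] at hd ⊢
    rw [degree_expo] at hd
    generalize d 0 = l at hd ⊢
    generalize d 1 = a at hd ⊢
    generalize d 2 = b at hd ⊢
    rcases (by omega : l = 0 ∧ a = 0 ∧ b = 0 ∨ l = 1 ∧ a = 0 ∧ b = 0 ∨ a = 1 ∨ b = 1) with
      ⟨rfl, rfl, rfl⟩ | ⟨rfl, rfl, rfl⟩ | rfl | rfl
    · have e0 : expo 0 0 0 = 0 := by simp [expo]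
      rw [e0, coeff_zero_eq_constantCoeff_apply, h0]
    · exact h1
    · exact coeff_expo_one_of_rot hr l b
    · exact coeff_expo_one_of_rot' hr l a
  obtain ⟨i, d, hd, hne⟩ := hq
  apply hne
  have hX : ∀ j : Fin 3, coeff d (X j : PS F) = 0 := by
    classical
    intro j
    rw [coeff_X, if_neg]
    rintro rfl
    simp at hd
  have e : v (X i) = rot F (X i) + f * euler F (X i) := by
    have := DFunLike.congr_fun hf (X i)
    rw [Derivation.sub_apply, smul_euler_apply] at this
    linear_combination this
  have h3 : coeff d (f * euler F (X i)) = 0 :=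
    mul_mem_orderIdeal hf2 (euler_mem_orderIdeal (X_mem_orderIdeal i)) d (by omega)
  rw [e, map_add, h3, add_zero]
  fin_cases i
  · simp
  · simpa using hX 2
  · simpa using hX 1

theorem inr_mem_permissibleGroup {φ : PS F ≃ₐ[F] PS F} (h : φ ∈ stateGroup F) :
    (SemidirectProduct.inr φ : OrbitalTransformation F) ∈ permissibleGroup F :=
  Subgroup.subset_closure (Or.inl ⟨_, h, rfl⟩)

theorem exists_unit {T : PS F} (h : constantCoeff T ≠ 0) : ∃ τ : (PS F)ˣ, (τ : PS F) = T :=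
  isUnit_iff_constantCoeff.2 (isUnit_iff_ne_zero.2 h)

theorem inl_smul (τ : (PS F)ˣ) (v : VF F) :
    (SemidirectProduct.inl τ : OrbitalTransformation F) • v = (τ : PS F) • v := by
  rw [smul_def', SemidirectProduct.left_inl, SemidirectProduct.right_inl]
  rfl

theorem inr_smul (φ : PS F ≃ₐ[F] PS F) (v : VF F) :
    (SemidirectProduct.inr φ : OrbitalTransformation F) • v = transport φ v := by
  rw [smul_def', SemidirectProduct.left_inr, SemidirectProduct.right_inr, Units.val_one, one_smul]

theorem powerSeries_decomposition {p : PowerSeries F} (hp : PowerSeries.constantCoeff p = 0) :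
    ∃ (r : ℕ) (b c : F) (u : PowerSeries F), 2 ≤ r ∧ PowerSeries.constantCoeff u = 1 ∧
      p = b • PowerSeries.X + c • (PowerSeries.X ^ r * u) := by
  classical
  by_cases h : ∃ r, 2 ≤ r ∧ PowerSeries.coeff r p ≠ 0
  · obtain ⟨h2, hr⟩ := Nat.find_spec h
    set r := Nat.find h
    obtain ⟨δ, hδ⟩ : PowerSeries.X ^ r ∣ p - PowerSeries.coeff 1 p • PowerSeries.X := by
      refine PowerSeries.X_pow_dvd_iff.2 fun m hm => ?_
      have := Nat.find_min h hm
      rw [map_sub, map_smul, PowerSeries.coeff_X, smul_eq_mul]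
      rcases (by omega : m = 0 ∨ m = 1 ∨ 2 ≤ m) with rfl | rfl | h2m
      · simpa using hp
      · simp
      · rw [if_neg (by omega), mul_zero, sub_zero]
        by_contra hne
        exact this ⟨h2m, hne⟩
    have hδ0 : PowerSeries.constantCoeff δ = PowerSeries.coeff r p := by
      have h1 := PowerSeries.coeff_X_pow_mul δ r 0
      rw [zero_add, ← hδ, map_sub, map_smul, PowerSeries.coeff_X, if_neg (by omega), smul_zero,
        sub_zero, PowerSeries.coeff_zero_eq_constantCoeff_apply] at h1
      exact h1.symm
    refine ⟨r, PowerSeries.coeff 1 p, PowerSeries.coeff r p, (PowerSeries.coeff r p)⁻¹ • δ, h2, ?_,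
      ?_⟩
    · rw [← PowerSeries.coeff_zero_eq_constantCoeff_apply, map_smul,
        PowerSeries.coeff_zero_eq_constantCoeff_apply, hδ0, smul_eq_mul, inv_mul_cancel₀ hr]
    · rw [mul_smul_comm, smul_smul, mul_inv_cancel₀ hr, one_smul, ← hδ]
      ring
  · push Not at h
    -- If p is linear, any r ≥ 2 serves with c = 0.
    refine ⟨2, PowerSeries.coeff 1 p, 0, 1, le_rfl, map_one _, ?_⟩
    rw [zero_smul, add_zero]
    ext m
    rw [map_smul, PowerSeries.coeff_X, smul_eq_mul]
    rcases (by omega : m = 0 ∨ m = 1 ∨ 2 ≤ m) with rfl | rfl | h2m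
    · simpa using hp
    · simp
    · rw [h m h2m, if_neg (by omega), mul_zero]

theorem eulerMonomial_mem_eulerGrade {l k n : ℕ} (h : l ≤ k) (hn : 2 * k = n + l) :
    eulerMonomial F l k ∈ eulerGrade F n :=
  Submodule.subset_span ⟨l, k, h, hn, rfl⟩

/-- A line that meets W trivially extends to a complement of W, which is then cut down to 𝓔ₙ. At
most one E⁰ₖ has grade n, so a single line suffices. For W not inside 𝓔ₙ the value is irrelevant. -/
theorem exists_compl (n : ℕ) (W : Submodule F (VF F)) : ∃ C : Submodule F (VF F),
    (W ≤ eulerGrade F n → Disjoint W C ∧ W ⊔ C = eulerGrade F n) ∧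
      ∀ k, n = 2 * k → eulerMonomial F 0 k ∉ W → eulerMonomial F 0 k ∈ C := by
  by_cases hW : W ≤ eulerGrade F n
  swap
  · exact ⟨⊤, fun h => absurd h hW, fun _ _ _ => Submodule.mem_top⟩
  have key : ∀ A : Submodule F (VF F), A ≤ eulerGrade F n → Disjoint W A →
      ∃ C : Submodule F (VF F), A ≤ C ∧ Disjoint W C ∧ W ⊔ C = eulerGrade F n := by
    intro A hA hdis
    obtain ⟨C, hAC, hC⟩ := hdis.symm.exists_isCompl
    refine ⟨C ⊓ eulerGrade F n, le_inf hAC hA, hC.disjoint.symm.mono_right inf_le_left, ?_⟩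
    -- The modular law, applicable because W ≤ 𝓔ₙ.
    rw [← sup_inf_assoc_of_le _ hW, hC.symm.sup_eq_top, top_inf_eq]
  by_cases h : ∃ k, n = 2 * k ∧ eulerMonomial F 0 k ∉ W
  · obtain ⟨k, rfl, hk⟩ := h
    obtain ⟨C, hC, h1, h2⟩ := key (Submodule.span F {eulerMonomial F 0 k})
      (by
        rw [Submodule.span_singleton_le_iff_mem]
        exact eulerMonomial_mem_eulerGrade (Nat.zero_le k) rfl)
      (Submodule.disjoint_span_singleton_of_notMem hk)
    refine ⟨C, fun _ => ⟨h1, h2⟩, fun k' hk' _ => ?_⟩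
    obtain rfl : k = k' := by omega
    exact (Submodule.span_singleton_le_iff_mem _ _).1 hC
  · obtain ⟨C, -, h1, h2⟩ := key ⊥ bot_le disjoint_bot_right
    exact ⟨C, fun _ => ⟨h1, h2⟩, fun k hk hk' => absurd ⟨k, hk, hk'⟩ h⟩

/-- A style that keeps the monomials `E⁰ₖ` in the normal form whenever this is possible. -/
def radialStyle (F : Type*) [Field F] : NormalFormStyle F where
  compl n W := (exists_compl n W).choose
  disjoint_compl n W h := ((exists_compl n W).choose_spec.1 h).1
  sup_compl n W h := ((exists_compl n W).choose_spec.1 h).2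

/-- The coefficients of the components of the normal form. -/
def nfPart (r : ℕ) (b c : F) (n : ℕ) : PS F :=
  (if n = 1 then X 0 else 0) + (if n = 2 then b • rhoSq F else 0) +
    (if n = 2 * r then c • rhoSq F ^ r else 0)

theorem rhoSq_pow_smul_euler (k : ℕ) : eulerMonomial F 0 k = rhoSq F ^ k • euler F := by
  rw [eulerMonomial, timeMonomial, pow_zero, one_mul, Nat.sub_zero]

theorem nfPart_mem_eulerGrade (r : ℕ) (b c : F) (n : ℕ) :
    nfPart r b c n • euler F ∈ eulerGrade F n := by
  rw [nfPart, add_smul, add_smul]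
  refine add_mem (add_mem ?_ ?_) ?_
  · split_ifs with h
    · subst h
      have := eulerMonomial_mem_eulerGrade (F := F) (l := 1) (k := 1) (n := 1) le_rfl rfl
      simpa [eulerMonomial, timeMonomial] using this
    · rw [zero_smul]
      exact zero_mem _
  · split_ifs with h
    · subst h
      have := eulerMonomial_mem_eulerGrade (F := F) (l := 0) (k := 1) (n := 2) (Nat.zero_le 1) rfl
      rw [rhoSq_pow_smul_euler, pow_one] at this
      rw [smul_assoc]
      exact Submodule.smul_mem _ _ this
    · rw [zero_smul]
      exact zero_mem _
  · split_ifs with h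
    · subst h
      have := eulerMonomial_mem_eulerGrade (F := F) (l := 0) (k := r) (n := 2 * r)
          (Nat.zero_le r) rfl
      rw [rhoSq_pow_smul_euler] at this
      rw [smul_assoc]
      exact Submodule.smul_mem _ _ this
    · rw [zero_smul]
      exact zero_mem _

theorem coeff_eq_sum_ite {m : ℕ} {a q : PS F} (ha : a ∈ orderIdeal F 3 m) (d : Fin 3 →₀ ℕ) :
    coeff d (a * q) =
      ∑ n ∈ Finset.range (d.degree + 1), coeff d ((if n = m then a else 0) * q) := by
  by_cases hm : m ≤ d.degree
  · rw [Finset.sum_eq_single m]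
    · rw [if_pos rfl]
    · intro n _ hn
      rw [if_neg hn, zero_mul, MvPowerSeries.coeff_zero]
    · intro h
      exact absurd (Finset.mem_range.2 (Nat.lt_succ_of_le hm)) h
  · rw [Finset.sum_eq_zero]
    · exact Ideal.mul_mem_right _ _ ha d (not_le.1 hm)
    · intro n hn
      rw [Finset.mem_range] at hn
      rw [if_neg (by omega), zero_mul, MvPowerSeries.coeff_zero]

theorem isGradeDecomposition_nfPart (r : ℕ) (b c : F) :
    IsGradeDecomposition (orbitalNF r b c - rot F) (fun n => nfPart r b c n • euler F) := by
  refine ⟨nfPart_mem_eulerGrade r b c, fun i d => ?_⟩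
  rw [orbitalNF_sub_rot, smul_euler_apply, nfSeries, add_mul, add_mul, map_add, map_add,
    coeff_eq_sum_ite (X_mem_orderIdeal 0), coeff_eq_sum_ite (smul_mem_orderIdeal b
      rhoSq_mem_orderIdeal), coeff_eq_sum_ite (smul_mem_orderIdeal c (rhoSq_pow_mem_orderIdeal r)),
    ← Finset.sum_add_distrib, ← Finset.sum_add_distrib]
  refine Finset.sum_congr rfl fun n _ => ?_
  rw [smul_euler_apply, nfPart, add_mul, add_mul, map_add, map_add]

theorem exists_smul_euler_of_mem_eulerGrade {n : ℕ} {S : VF F} (h : S ∈ eulerGrade F n) :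
    ∃ g : PS F, S = g • euler F := by
  have hle : eulerGrade F n ≤ LinearMap.range (mulEuler F) := by
    refine Submodule.span_le.2 ?_
    rintro _ ⟨l, k, -, -, rfl⟩
    exact ⟨timeMonomial F l k, rfl⟩
  obtain ⟨g, hg⟩ := hle h
  exact ⟨g, hg.symm⟩

theorem infAction_smul_euler (f g T : PS F) : infAction (f • euler F) (g • euler F, T) =
    (g * euler F f - f * euler F g + T * f) • euler F := by
  change ⁅g • euler F, f • euler F⁆ + T • f • euler F = _
  ext1 q
  rw [Derivation.add_apply, Derivation.commutator_apply]
  simp only [Derivation.smul_apply, Derivation.leibniz, smul_eq_mul]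
  ring

theorem nfPart_one (r : ℕ) (b c : F) : nfPart r b c 1 = X 0 := by
  rw [nfPart, if_pos rfl, if_neg (by omega), if_neg (by omega), add_zero, add_zero]

variable [CharZero F]

theorem inl_mem_permissibleGroup {τ : (PS F)ˣ} (h : rot F (τ : PS F) = 0) :
    (SemidirectProduct.inl τ : OrbitalTransformation F) ∈ permissibleGroup F :=
  Subgroup.subset_closure (Or.inr ⟨_, mem_range_planar.2 h, rfl⟩)

/-- If T f = x + b w + c w^r u and the flow φ satisfies H^(r-1) = u, then φ maps the normal form
series to H T f. So φ transports the normal form to H T k · f E, and f E is brought to normal form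
by rescaling with H T k and then applying φ⁻¹. -/
theorem exists_orbitallyEquivalent_orbitalNF {v : VF F} (hv : v - rot F ∈ eulerSpace F)
    (hq : HasNonzeroQuadraticPart v) :
    ∃ (r : ℕ) (b c : F), 2 ≤ r ∧ OrbitallyEquivalent v (orbitalNF r b c) := by
  obtain ⟨f, hfr, hf0, hf⟩ := mem_eulerSpace.1 hv
  obtain ⟨T, p, hTr, hT0, hp0, hT⟩ := exists_mul_eq_X_add_radial hfr hf0
    (coeff_expo_one_ne_zero_of_quadraticPart hfr hf0 hf hq)
  obtain ⟨r, b, c, u, hr, hu, rfl⟩ := powerSeries_decomposition hp0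
  obtain ⟨g, hgr, hg0, hg⟩ := exists_flow_rhoSq_pow (m := r - 1) (by omega) hu
  obtain ⟨φ, hφs, hφ⟩ := exists_mem_stateGroup_isExp hgr hg0
  have hs := hφ.isEquivariantScaling hgr hg0
  obtain ⟨k, hkr, hk0, hk⟩ := hs.transport_euler
  obtain ⟨H, hH, h0, hw⟩ := hs.exists_scale
  have hHr : rot F H = 0 := by
    refine rot_eq_zero_of_mul rot_X_zero (X_ne_zero' 0) ?_
    rw [mul_comm, ← h0, ← hs.1, rot_X_zero, map_zero]
  have hpow : H ^ (r - 1) = radial F u := by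
    have := hg φ hφ
    rw [map_pow, hw, mul_pow] at this
    exact mul_right_cancel₀ (pow_ne_zero _ rhoSq_ne_zero) this
  have hnf : φ (nfSeries r b c) = H * (T * f) := by
    rw [IsEquivariantScaling.apply_nfSeries h0 hw (by omega), hT, hpow, map_add, map_smul, map_smul,
      map_mul, map_pow, radial_X, add_assoc]
  obtain ⟨τ, hτ⟩ := exists_unit (T := H * T * k) (by
    rw [map_mul, map_mul, hH, hk0, one_mul, mul_one]
    exact hT0)
  have hτr : rot F (τ : PS F) = 0 := by
    rw [hτ]
    exact rot_mul (rot_mul hHr hTr) hkr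
  refine ⟨r, b, c, hr, (SemidirectProduct.inr φ)⁻¹ * SemidirectProduct.inl τ,
    mul_mem (inv_mem (inr_mem_permissibleGroup hφs)) (inl_mem_permissibleGroup hτr), ?_⟩
  rw [← sub_eq_iff_eq_add', orbitalNF_sub_rot, mul_smul, eq_inv_smul_iff, inr_smul, inl_smul,
    transport_smul, hk, hnf, hf, hτ, smul_smul, smul_smul]
  congr 1
  ring

/-- Below grade 2r only x and b w occur, and both have E-weight one; the term c w^r has weight r. -/
theorem euler_nfPart {r : ℕ} (b c : F) {n : ℕ} (hn : n < 2 * r) :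
    euler F (nfPart r b c n) = nfPart r b c n := by
  rw [nfPart, if_neg (by omega : ¬n = 2 * r)]
  split_ifs <;> simp [Derivation.map_smul]

/-- The monomials `E⁰ₖ` with `k ≤ r` cannot be removed. -/
theorem eulerMonomial_notMem_removable {r k : ℕ} (hk : 1 ≤ k) (hkr : k ≤ r) (b c : F) :
    eulerMonomial F 0 k ∉ removable (fun n => nfPart r b c n • euler F) (2 * k) := by
  rintro ⟨Y, ⟨hY, hker⟩, hval⟩
  have hY1 : ∀ j, ∃ g : PS F, (Y j).1 = g • euler F := fun j =>
    exists_smul_euler_of_mem_eulerGrade (hY j (Set.mem_univ j)).1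
  choose g hg using hY1
  -- As E p = p for the components p of lower grade, (g E, T) * (p E) = (g - E g + T) p E: state and
  -- time generators enter only through this multiplier.
  set q : ℕ → PS F := fun j => g j - euler F (g j) + (Y j).2 with hq
  have hlevel : ∀ n, n ≤ 2 * r → levelMap (fun n => nfPart r b c n • euler F) n Y =
      (∑ i ∈ Finset.Ico 1 n, nfPart r b c i * q (n - i)) • euler F := by
    intro n hn
    rw [levelMap, LinearMap.sum_apply, Finset.sum_smul]
    refine Finset.sum_congr rfl fun i hi => ?_
    rw [Finset.mem_Ico] at hi
    rw [LinearMap.comp_apply, LinearMap.proj_apply,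
      show Y (n - i) = (g (n - i) • euler F, (Y (n - i)).2) from Prod.ext (hg _) rfl,
      infAction_smul_euler, euler_nfPart b c (by omega : i < 2 * r)]
    congr 1
    simp only [hq]
    ring
  have hsum : ∀ n, 2 ≤ n → (∀ j, 1 ≤ j → j < n - 1 → q j = 0) →
      ∑ i ∈ Finset.Ico 1 n, nfPart r b c i * q (n - i) = X 0 * q (n - 1) := by
    intro n hn hj
    rw [Finset.sum_eq_single 1]
    · rw [nfPart_one]
    · intro i hi hi1
      rw [Finset.mem_Ico] at hi
      rw [hj (n - i) (by omega) (by omega), mul_zero]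
    · intro h
      exact absurd (Finset.mem_Ico.2 ⟨le_rfl, by omega⟩) h
  -- Once the earlier multipliers vanish, the equation of grade j + 1 reads x q_j = 0.
  have hq0 : ∀ j, 1 ≤ j → j < 2 * k - 1 → q j = 0 := by
    intro j
    induction j using Nat.strong_induction_on with
    | _ j ih =>
      intro hj1 hj2
      have h1 : levelMap (fun n => nfPart r b c n • euler F) (j + 1) Y = 0 := by
        have := (Submodule.mem_iInf _).1 hker (j + 1)
        exact (Submodule.mem_iInf _).1 this (Finset.mem_range.2 (by omega))
      rw [hlevel _ (by omega), hsum _ (by omega) fun i hi1 hi2 => ih i (by omega) hi1 (by omega),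
        Nat.add_sub_cancel] at h1
      have h2 := smul_euler_inj (h1.trans (zero_smul (PS F) (euler F)).symm)
      exact (mul_eq_zero.1 h2).resolve_left (X_ne_zero' 0)
  rw [hlevel _ (by omega), hsum _ (by omega) hq0, rhoSq_pow_smul_euler] at hval
  -- The value at grade 2k is x q_(2k-1), which has no term y^(2k), whereas w^k has one.
  have h3 := congrArg (coeff (expo 0 (2 * k) 0)) (smul_euler_inj hval)
  rw [coeff_expo_zero_X_zero_mul, ← radial_X, ← map_pow, coeff_radial, if_pos rfl,
    PowerSeries.coeff_X_pow_self] at h3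
  exact zero_ne_one h3

theorem isInfiniteLevel_orbitalNF {r : ℕ} (hr : 2 ≤ r) (b c : F) :
    IsInfiniteLevel (radialStyle F) (orbitalNF r b c) := by
  refine ⟨_, isGradeDecomposition_nfPart r b c, fun n hn => ?_⟩
  have hC := (exists_compl n (removable (fun n => nfPart r b c n • euler F) n)).choose_spec
  change nfPart r b c n • euler F ∈ (exists_compl n _).choose
  rcases eq_or_ne n 1 with rfl | hn1
  · have hbot : removable (fun n => nfPart r b c n • euler F) 1 = ⊥ := by
      rw [removable, levelMap, Finset.Ico_self, Finset.sum_empty, Submodule.map_zero]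
    have h2 := (hC.1 (hbot ▸ bot_le)).2
    have h3 : removable (fun n => nfPart r b c n • euler F) 1 ⊔
        (exists_compl 1 (removable (fun n => nfPart r b c n • euler F) 1)).choose =
        (exists_compl 1 (removable (fun n => nfPart r b c n • euler F) 1)).choose :=
      sup_eq_right.2 (hbot.le.trans bot_le)
    rw [h3] at h2
    rw [h2]
    exact nfPart_mem_eulerGrade r b c 1
  · rw [nfPart, if_neg hn1, zero_add, add_smul]
    refine add_mem ?_ ?_
    · split_ifs with h
      · subst h
        have := hC.2 1 rfl (eulerMonomial_notMem_removable le_rfl (by omega) b c)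
        rw [rhoSq_pow_smul_euler, pow_one] at this
        rw [smul_assoc]
        exact Submodule.smul_mem _ _ this
      · rw [zero_smul]
        exact zero_mem _
    · split_ifs with h
      · subst h
        have := hC.2 r rfl (eulerMonomial_notMem_removable (by omega) le_rfl b c)
        rw [rhoSq_pow_smul_euler] at this
        rw [smul_assoc]
        exact Submodule.smul_mem _ _ this
      · rw [zero_smul]
        exact zero_mem _

end NormalForm

/-! ### The symmetry group and its generators. -/

section Symmetries

variable {F : Type*} [Field F]

theorem countable_of_group_fg {G : Type*} [Group G] (h : Group.FG G) : Countable G := by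
  obtain ⟨S, hS, φ, hφ⟩ := Monoid.fg_iff_exists_freeMonoid_hom_surjective.1
    (Group.fg_iff_monoid_fg.1 h)
  have : Countable S := hS.countable
  have : Countable (FreeMonoid S) := inferInstanceAs (Countable (List S))
  exact hφ.countable

theorem nfSeries_eq_X_add_radial (r : ℕ) (b c : F) : nfSeries r b c =
    X 0 + radial F (b • PowerSeries.X + c • PowerSeries.X ^ r) := by
  rw [nfSeries, map_add, map_smul, map_smul, map_pow, radial_X, add_assoc]

theorem nfSeries_notMem_orderIdeal (r : ℕ) (b c : F) :
    nfSeries r b c ∉ orderIdeal F 3 (1 + 1) := by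
  intro h
  have := h (expo 1 0 0) (by simp)
  rw [nfSeries_eq_X_add_radial, map_add, coeff_expo_X_zero, coeff_expo_radial_one, add_zero] at this
  exact one_ne_zero this

theorem X_zero_notMem_orderIdeal : (X 0 : PS F) ∉ orderIdeal F 3 (1 + 1) := by
  intro h
  have := h (expo 1 0 0) (by simp)
  rw [coeff_expo_X_zero] at this
  exact one_ne_zero this

theorem nfSeries_ne_zero (r : ℕ) (b c : F) : nfSeries r b c ≠ 0 := fun h =>
  nfSeries_notMem_orderIdeal r b c (h ▸ zero_mem _)

theorem radial_injective : Function.Injective (radial F) := by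
  intro p q h
  ext n
  have h1 := coeff_radial 0 n p
  rw [h, coeff_radial, if_pos rfl, if_pos rfl] at h1
  exact h1.symm

/-- The generators `(f q E, f (E q))` of the symmetries of `f E`. -/
def symmetryGenerator (f : PS F) : PS F →ₗ[F] VF F × PS F :=
  (mulEuler F ∘ₗ LinearMap.mulLeft F f).prod (LinearMap.mulLeft F f ∘ₗ (euler F).toLinearMap)

theorem infAction_symmetryGenerator (f q : PS F) :
    infAction (f • euler F) (symmetryGenerator f q) = 0 := by
  change infAction (f • euler F) ((f * q) • euler F, f * euler F q) = 0
  rw [infAction_smul_euler, Derivation.leibniz, smul_eq_mul, smul_eq_mul]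
  convert zero_smul (PS F) (euler F) using 2
  ring

theorem symmetryGenerator_injective {f : PS F} (hf : f ≠ 0) :
    Function.Injective (symmetryGenerator f) := by
  intro p q h
  have h1 : (f * p) • euler F = (f * q) • euler F := congrArg Prod.fst h
  exact mul_left_cancel₀ hf (smul_euler_inj h1)

/-- If `exp (f q E)` and `exp (f q' E)` agree, where `f` is of order one, then `q = q'`. -/
theorem eq_of_expOp_eq {f q q' : PS F} (h0 : constantCoeff f = 0)
    (hf : f ∉ orderIdeal F 3 (1 + 1))
    (h : expOp ((f * q) • euler F).toLinearMap (X 0) =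
      expOp ((f * q') • euler F).toLinearMap (X 0)) : q = q' := by
  refine eq_of_forall_sub_mem_orderIdeal fun N => ?_
  induction N with
  | zero => exact mem_orderIdeal_zero _
  | succ N ih =>
    have hz : ∀ p : PS F, constantCoeff (f * p) = 0 := fun p => by rw [map_mul, h0, zero_mul]
    have hsub : ((f * q) • euler F).toLinearMap - ((f * q') • euler F).toLinearMap =
        ((f * (q - q')) • euler F).toLinearMap := by
      rw [mul_sub]
      ext1 p
      exact (sub_mul _ _ _).symm
    have hraise : RaisesOrder (((f * q) • euler F).toLinearMap -
        ((f * q') • euler F).toLinearMap) (1 + N) := by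
      rw [hsub]
      exact raisesOrder_smul_euler (mul_mem_orderIdeal (mem_orderIdeal_one.2 h0) ih)
    have h1 := expOp_sub_expOp_sub_mem (raisesOrder_one_smul_euler (hz q))
      (raisesOrder_one_smul_euler (hz q')) hraise (X_mem_orderIdeal 0)
    rw [h, sub_self, zero_sub, neg_mem_iff, ← LinearMap.sub_apply, hsub] at h1
    change f * (q - q') * euler F (X 0) ∈ _ at h1
    rw [euler_X_zero, mul_assoc, mul_comm (q - q'),
      show 1 + (1 + N) + 1 = 1 + (1 + (N + 1)) by ring] at h1
    -- The lowest-order difference of the two exponentials at x is f (q - q') x. As it vanishes to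
    -- one order more, division by x and by f, both of order one, gains one order for q - q'.
    exact mem_orderIdeal_of_mul_mem X_zero_notMem_orderIdeal (mem_orderIdeal_of_mul_mem hf h1)

theorem map_smul_euler_of_transport {φ : PS F ≃ₐ[F] PS F} {S : VF F} (h : transport φ S = S)
    (q : PS F) : φ (S q) = S (φ q) := by
  have := DFunLike.congr_fun h (φ q)
  rwa [transport_apply, AlgEquiv.symm_apply_apply] at this

theorem transport_eq_of_isExp_smul {f : PS F} (h0 : constantCoeff f = 0) {t : F}
    {φ : PS F ≃ₐ[F] PS F} (hφ : IsExp (t • f • euler F) φ) :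
    transport φ (f • euler F) = f • euler F := by
  have h0' : constantCoeff (t • f) = 0 := by rw [smul_eq_C_mul, map_mul, h0, mul_zero]
  rw [← smul_assoc] at hφ
  have hR := raisesOrder_one_smul_euler h0'
  have hcomm : ∀ q, (f • euler F) (φ q) = φ ((f • euler F) q) := by
    intro q
    rw [isExp_iff.1 hφ, isExp_iff.1 hφ]
    refine map_expOp (T := (f • euler F).toLinearMap) hR hR 0 (fun N q hq => ?_) (fun q => ?_) q
    · exact Ideal.mul_mem_left _ _ (euler_mem_orderIdeal hq)
    · change f * euler F ((t • f) * euler F q) = (t • f) * euler F (f * euler F q)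
      rw [smul_mul_assoc, smul_mul_assoc, Derivation.map_smul, mul_smul_comm]
  ext1 q
  rw [transport_apply, ← hcomm, AlgEquiv.apply_symm_apply]

theorem expOp_zero_apply (q : PS F) : expOp 0 q = q := by
  ext d
  rw [expOp, coeff_ofCoeff, Finset.sum_range_succ', Finset.sum_eq_zero]
  · simp
  · intro n _
    rw [pow_succ, mul_zero, LinearMap.zero_apply, MvPowerSeries.coeff_zero, mul_zero]

/-- The equation for the factor `H` of a symmetry `x ↦ H x`, `w ↦ H w` of `f E`, where `f` is
`x + b w + c w ^ r`. -/
def SymmetryEquation (r : ℕ) (b c : F) (H : PS F) : Prop :=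
  H * (H * (X 0 + b • rhoSq F + c • (rhoSq F ^ r * H ^ (r - 1)))) =
    nfSeries r b c * (euler F H + H)

theorem symmetryEquation_of_transport {φ : PS F ≃ₐ[F] PS F} {H : PS F} (h0 : φ (X 0) = H * X 0)
    (hw : φ (rhoSq F) = H * rhoSq F) {r : ℕ} (hr : r ≠ 0) {b c : F}
    (h : transport φ (nfSeries r b c • euler F) = nfSeries r b c • euler F) :
    SymmetryEquation r b c H := by
  have h1 := map_smul_euler_of_transport h (X 0)
  rw [smul_euler_apply, smul_euler_apply, euler_X_zero, map_mul, h0, Derivation.leibniz,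
    euler_X_zero, IsEquivariantScaling.apply_nfSeries h0 hw hr] at h1
  refine mul_right_cancel₀ (X_ne_zero' 0) ?_
  rw [smul_eq_mul, smul_eq_mul] at h1
  linear_combination h1

/-- The symmetry equation in terms of `η = H - 1`. -/
theorem SymmetryEquation.exists_eq {r : ℕ} (hr : r ≠ 0) {b c : F} {H : PS F}
    (hH : constantCoeff H = 1) (h : SymmetryEquation r b c H) :
    ∃ A : PS F, constantCoeff A = r + 1 ∧
      nfSeries r b 0 * ((H - 1) - euler F (H - 1) + (H - 1) ^ 2) +
        c • rhoSq F ^ r * ((H - 1) * A - (H - 1) - euler F (H - 1)) = 0 := by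
  -- The geometric sum satisfies (H - 1) A = H^(r+1) - 1, and its constant term is r + 1 because
  -- H(0) = 1.
  refine ⟨∑ i ∈ Finset.range (r + 1), H ^ i, ?_, ?_⟩
  · rw [map_sum]
    simp [hH]
  · have hg := geom_sum_mul H (r + 1)
    obtain ⟨s, rfl⟩ := Nat.exists_eq_succ_of_ne_zero hr
    rw [SymmetryEquation, nfSeries, Nat.succ_sub_one] at h
    rw [nfSeries, zero_smul, add_zero, map_sub, Derivation.map_one_eq_zero, sub_zero]
    simp only [smul_eq_C_mul, Nat.succ_eq_add_one] at h hg ⊢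
    set A := ∑ i ∈ Finset.range (s + 1 + 1), H ^ i
    linear_combination h + C c * rhoSq F ^ (s + 1) * hg

variable [CharZero F]

/-- Already the polynomials q in w inject into the space of generators through (f q E, f (E q)). -/
theorem not_finite_coNormalSpace {r : ℕ} (hr : r ≠ 0) (b c : F) :
    ¬ Module.Finite F (coNormalSpace (orbitalNF r b c)) := by
  intro hfin
  set f := nfSeries r b c
  have hf0 : constantCoeff f = 0 := constantCoeff_nfSeries hr b c
  have hmem : ∀ p : PowerSeries F,
      symmetryGenerator f (radial F p) ∈ coNormalSpace (orbitalNF r b c) := by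
    intro p
    refine ⟨⟨mem_eulerSpace.2
      ⟨f * radial F p, rot_mul (rot_nfSeries r b c) (rot_radial p), ?_, rfl⟩,
      mem_timeSpace.2 ⟨rot_mul (rot_nfSeries r b c) ?_, ?_⟩⟩, ?_⟩
    · rw [map_mul, hf0, zero_mul]
    · change rot F (euler F (radial F p)) = 0
      rw [← euler_rot_comm, rot_radial, map_zero]
    · change constantCoeff (f * _) = 0
      rw [map_mul, hf0, zero_mul]
    · rw [SetLike.mem_coe, LinearMap.mem_ker, orbitalNF_sub_rot]
      exact infAction_symmetryGenerator f _
  let M : Polynomial F →ₗ[F] coNormalSpace (orbitalNF r b c) :=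
    LinearMap.codRestrict _ (symmetryGenerator f ∘ₗ (radial F).toLinearMap ∘ₗ
      (Polynomial.coeToPowerSeries.algHom F).toLinearMap) fun p => hmem _
  have hM : Function.Injective M := by
    intro p q h
    have h1 := radial_injective (symmetryGenerator_injective (nfSeries_ne_zero r b c)
      (congrArg Subtype.val h))
    simpa using h1
  have := isNoetherian_of_isNoetherianRing_of_finite F (coNormalSpace (orbitalNF r b c))
  have := Module.Finite.of_injective M hM
  exact Polynomial.not_finite this

/-- The series f is an eigenvector of f q E, with eigenvalue q (E f), so exp(f q E) maps f to a unit
times f and f E to a unit times f E. A time rescaling compensates for that unit. -/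
theorem exists_symmetry {f : PS F} (hr : rot F f = 0) (h0 : constantCoeff f = 0) (hf : f ≠ 0)
    {q : PS F} (hq : rot F q = 0) : ∃ s : OrbitalTransformation F,
      s ∈ permissibleGroup F ∧ s • f • euler F = f • euler F ∧
        IsExp ((f * q) • euler F) s.right := by
  have hg0 : constantCoeff (f * q) = 0 := by rw [map_mul, h0, zero_mul]
  have hgr : rot F (f * q) = 0 := rot_mul hr hq
  obtain ⟨φ, hφs, hφ⟩ := exists_mem_stateGroup_isExp hgr hg0
  have hs := hφ.isEquivariantScaling hgr hg0
  obtain ⟨k, hkr, hk0, hk⟩ := hs.transport_euler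
  have hl : constantCoeff (q * euler F f) = 0 := by rw [map_mul, constantCoeff_euler, mul_zero]
  have h1 := hφ.apply_eigen hg0 (a := f) hl (by ring)
  set U := expFactor (f * q) (q * euler F f)
  have hU1 : constantCoeff U = 1 := constantCoeff_expFactor hg0 hl
  have hUr : rot F U = 0 := by
    refine rot_eq_zero_of_mul hr hf ?_
    rw [mul_comm, ← h1, ← hs.1, hr, map_zero]
  obtain ⟨τ, hτ⟩ := exists_unit (T := U * k) (by
    rw [map_mul, hU1, hk0, one_mul]
    exact one_ne_zero)
  refine ⟨(SemidirectProduct.inl τ)⁻¹ * SemidirectProduct.inr φ,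
    mul_mem (inv_mem (inl_mem_permissibleGroup (by rw [hτ]; exact rot_mul hUr hkr)))
      (inr_mem_permissibleGroup hφs), ?_, ?_⟩
  · rw [mul_smul, inv_smul_eq_iff, inr_smul, inl_smul, transport_smul, h1, hk, hτ, smul_smul,
      smul_smul]
    congr 1
    ring
  · have : ((SemidirectProduct.inl τ)⁻¹ * SemidirectProduct.inr φ : OrbitalTransformation F).right =
        φ := by
      simp
    rw [this]
    exact hφ

theorem not_fg_symmetryGroup {r : ℕ} (hr : r ≠ 0) (b c : F) :
    ¬ Group.FG (symmetryGroup (orbitalNF r b c)) := by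
  intro hfg
  have := countable_of_group_fg hfg
  have h0 := constantCoeff_nfSeries hr b c
  have hex := fun p : PowerSeries F => exists_symmetry (rot_nfSeries r b c) h0
    (nfSeries_ne_zero r b c) (rot_radial p)
  choose s hs hfix hexp using hex
  let Ψ : (ℕ → F) → symmetryGroup (orbitalNF r b c) := fun a =>
    ⟨s (PowerSeries.mk a), hs _, by
      change s _ • (orbitalNF r b c - rot F) = _
      rw [orbitalNF_sub_rot]
      exact hfix _⟩
  have hΨ : Function.Injective Ψ := by
    intro a a' h
    have h1 : s (PowerSeries.mk a) = s (PowerSeries.mk a') := congrArg Subtype.val h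
    have h2 : PowerSeries.mk a = PowerSeries.mk a' := radial_injective <|
      eq_of_expOp_eq h0 (nfSeries_notMem_orderIdeal r b c) (by
        rw [← isExp_iff.1 (hexp (PowerSeries.mk a)), ← isExp_iff.1 (hexp (PowerSeries.mk a')), h1])
    funext n
    simpa using congrArg (PowerSeries.coeff n) h2
  have hcount : Countable (ℕ → F) := hΨ.countable
  -- Cantor's diagonal argument shows that the sequences in F are uncountable, even if F is
  -- countable.
  obtain ⟨e, he⟩ := exists_surjective_nat (ℕ → F)
  obtain ⟨n, hn⟩ := he fun n => e n n + 1
  simpa using congrFun hn n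

/-- Modulo higher order the equation reads (x + b w)(η - E η) = 0 for η = H - 1, so the lowest terms
of η have E-weight one: they are x and the quadratic monomials in y and z. The vanishing
coefficients of x and y², with invariance, exclude all of these. -/
theorem SymmetryEquation.mem_orderIdeal_succ {r : ℕ} (hr : 2 ≤ r) {b c : F} {H : PS F}
    (hHr : rot F H = 0) (hH : constantCoeff H = 1) (h : SymmetryEquation r b c H)
    (h1 : coeff (expo 1 0 0) (H - 1) = 0) (h2 : coeff (expo 0 2 0) (H - 1) = 0) {N : ℕ}
    (hN : H - 1 ∈ orderIdeal F 3 (N + 1)) : H - 1 ∈ orderIdeal F 3 (N + 2) := by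
  obtain ⟨A, -, hA⟩ := h.exists_eq (by omega) hH
  have hηr : rot F (H - 1) = 0 := by
    rw [map_sub, hHr, Derivation.map_one_eq_zero, sub_zero]
  set η := H - 1
  have hf : nfSeries r b 0 ∈ orderIdeal F 3 1 :=
    mem_orderIdeal_one.2 (constantCoeff_nfSeries (by omega) b 0)
  have e1 : nfSeries r b 0 * (η - euler F η) = -(nfSeries r b 0 * (η * η)) -
      c • rhoSq F ^ r * (η * A - η - euler F η) := by
    linear_combination hA
  have h3 : nfSeries r b 0 * (η - euler F η) ∈ orderIdeal F 3 (1 + (N + 2)) := by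
    rw [e1]
    refine sub_mem (neg_mem ?_) ?_
    · exact orderIdeal_anti (by omega) (mul_mem_orderIdeal hf (mul_mem_orderIdeal hN hN))
    · refine orderIdeal_anti (by omega : 1 + (N + 2) ≤ 2 * r + (N + 1)) (mul_mem_orderIdeal
        (smul_mem_orderIdeal c (rhoSq_pow_mem_orderIdeal r)) ?_)
      exact sub_mem (sub_mem (Ideal.mul_mem_right _ _ hN) hN) (euler_mem_orderIdeal hN)
  have h4 := mem_orderIdeal_of_mul_mem (nfSeries_notMem_orderIdeal r b 0) h3
  intro d hd
  have h5 := h4 d hd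
  rw [map_sub, coeff_euler] at h5
  by_contra hne
  have h6 : (1 : F) - (d 0 + 2⁻¹ * d 1 + 2⁻¹ * d 2) = 0 := by
    refine (mul_eq_zero.1 ?_).resolve_right hne
    linear_combination h5
  have h7 : ((2 * d 0 + d 1 + d 2 : ℕ) : F) = (2 : ℕ) := by
    have h2ne : (2 : F) * 2⁻¹ = 1 := mul_inv_cancel₀ two_ne_zero
    push_cast
    linear_combination (-2 : F) * h6 - ((d 1 : F) + d 2) * h2ne
  have h8 : 2 * d 0 + d 1 + d 2 = 2 := Nat.cast_injective h7
  apply hne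
  rw [← expo_apply d]
  rcases (by omega : d 0 = 1 ∧ d 1 = 0 ∧ d 2 = 0 ∨ d 0 = 0 ∧ d 1 = 2 ∧ d 2 = 0 ∨ d 2 = 1 ∨
    d 0 = 0 ∧ d 1 = 0 ∧ d 2 = 2) with ⟨e0, e1, e2⟩ | ⟨e0, e1, e2⟩ | e2 | ⟨e0, e1, e2⟩
  · rw [e0, e1, e2, h1]
  · rw [e0, e1, e2, h2]
  · rw [e2, coeff_expo_one_of_rot' hηr]
  · rw [e0, e1, e2]
    have h9 := coeff_expo_rot_relation hηr 0 0 0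
    rw [h2, mul_zero] at h9
    exact (mul_eq_zero.1 h9.symm).resolve_left (Nat.cast_add_one_ne_zero _)

/-- On x + b w = 0 only the multiple of c w^r survives, so η A - η - E η = 0 there. Its coefficient
at t² is (r + 1) - 1 - 1 = r - 1 times that of η, and r - 1 ≠ 0. -/
theorem SymmetryEquation.coeff_rhoSq_eq {r : ℕ} (hr : 2 ≤ r) {b c : F} (hc : c ≠ 0) {H : PS F}
    (hHr : rot F H = 0) (hH : constantCoeff H = 1) (h : SymmetryEquation r b c H) :
    coeff (expo 0 2 0) (H - 1) = b * coeff (expo 1 0 0) (H - 1) := by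
  have hr0 : r ≠ 0 := by omega
  obtain ⟨A, hA0, hA⟩ := h.exists_eq hr0 hH
  have hη0 : constantCoeff (H - 1) = 0 := by rw [map_sub, hH, constantCoeff_one, sub_self]
  have hηr : rot F (H - 1) = 0 := by
    rw [map_sub, hHr, Derivation.map_one_eq_zero, sub_zero]
  set η := H - 1
  have hp1 : PowerSeries.coeff 1 (nfCurve r b (0 : F)) = 0 := by
    rw [coeff_nfCurve, if_neg (by omega), if_neg (by omega)]
    simp
  have hp2 : PowerSeries.coeff 2 (nfCurve r b (0 : F)) = -b := by
    rw [coeff_nfCurve, if_pos rfl]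
    simp
  have hp := constantCoeff_nfCurve hr0 b (0 : F)
  have h1 := congrArg (curve hp) hA
  rw [map_add, map_mul, curve_nfSeries hr0, zero_mul, zero_add, map_mul, map_zero, map_smul,
    map_pow, curve_rhoSq] at h1
  have hX : c • ((PowerSeries.X ^ 2) ^ r : PowerSeries F) ≠ 0 :=
    smul_ne_zero hc (pow_ne_zero _ (pow_ne_zero _ PowerSeries.X_ne_zero))
  have h2 := congrArg (PowerSeries.coeff 2) ((mul_eq_zero.1 h1).resolve_left hX)
  rw [map_sub, map_sub, map_sub, map_sub, map_mul, map_zero] at h2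
  obtain ⟨δ, hδ⟩ : PowerSeries.X ^ 2 ∣ curve hp η := by
    refine PowerSeries.X_pow_dvd_iff.2 fun m hm => ?_
    interval_cases m
    · rw [PowerSeries.coeff_zero_eq_constantCoeff_apply, constantCoeff_curve, hη0]
    · rw [coeff_one_curve hp hp1, coeff_expo_one_of_rot hηr]
  have e1 : PowerSeries.coeff 2 (curve hp η * curve hp A) =
      PowerSeries.coeff 2 (curve hp η) * (r + 1) := by
    rw [hδ, mul_assoc]
    have h3 := PowerSeries.coeff_X_pow_mul (δ * curve hp A) 2 0
    have h4 := PowerSeries.coeff_X_pow_mul δ 2 0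
    rw [zero_add] at h3 h4
    rw [h3, h4, PowerSeries.coeff_zero_eq_constantCoeff_apply, map_mul, constantCoeff_curve, hA0,
      PowerSeries.coeff_zero_eq_constantCoeff_apply]
  rw [e1, coeff_two_curve hp hp1, coeff_two_curve hp hp1, hp2, coeff_euler, coeff_euler] at h2
  simp only [expo_zero, expo_one, expo_two, Nat.cast_zero, Nat.cast_one, Nat.cast_ofNat, mul_zero,
    add_zero, zero_add, one_mul, inv_mul_cancel₀ (two_ne_zero' F)] at h2
  have h3 : (r : F) - 1 ≠ 0 := by
    rw [sub_ne_zero, Nat.cast_ne_one]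
    omega
  refine mul_left_cancel₀ h3 ?_
  linear_combination h2

theorem eq_one_of_symmetryEquation {r : ℕ} (hr : 2 ≤ r) {b c : F} (hc : c ≠ 0) {H : PS F}
    (hHr : rot F H = 0) (hH : constantCoeff H = 1) (h : SymmetryEquation r b c H)
    (h1 : coeff (expo 1 0 0) (H - 1) = 0) : H = 1 := by
  have h2 := h.coeff_rhoSq_eq hr hc hHr hH
  rw [h1, mul_zero] at h2
  refine sub_eq_zero.1 (eq_zero_of_forall_mem_orderIdeal fun N => ?_)
  refine orderIdeal_anti (Nat.le_succ N) ?_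
  induction N with
  | zero => exact mem_orderIdeal_one.2 (by rw [map_sub, hH, constantCoeff_one, sub_self])
  | succ N ih => exact h.mem_orderIdeal_succ hr hHr hH h1 h2 ih

theorem IsEquivariantScaling.eq_one {φ : PS F ≃ₐ[F] PS F} (hφ : IsEquivariantScaling φ)
    (h : φ (X 0) = X 0) : φ = 1 := by
  obtain ⟨-, G, hG, h0, h1, h2⟩ := hφ
  have h3 : G ^ 2 = 1 := mul_right_cancel₀ (X_ne_zero' 0) (by rw [← h0, h, one_mul])
  have h4 : G = 1 := by
    -- The root G = -1 is excluded by G(0) = 1 in characteristic zero.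
    refine (mul_self_eq_one_iff.1 ((sq G).symm.trans h3)).resolve_right fun h4 => ?_
    rw [h4, map_neg, constantCoeff_one] at hG
    exact one_ne_zero (self_eq_neg.1 hG.symm)
  refine algEquiv_eq_one fun i => ?_
  fin_cases i
  · exact h
  · change φ (X 1) = X 1
    rw [h1, h4, one_mul]
  · change φ (X 2) = X 2
    rw [h2, h4, one_mul]

/-- The time t is the coefficient of x in H, since exp(t f E) multiplies x by 1 + t f + ⋯. Dividing
φ by this flow leaves a symmetry θ whose factor has no x-term, and such a symmetry is the identity.
-/
theorem exists_isExp_of_transport {r : ℕ} (hr : 2 ≤ r) {b c : F} (hc : c ≠ 0)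
    {φ : PS F ≃ₐ[F] PS F} (hφ : φ ∈ stateGroup F)
    (h : transport φ (nfSeries r b c • euler F) = nfSeries r b c • euler F) :
    ∃ t : F, IsExp (t • nfSeries r b c • euler F) φ := by
  have hr0 : r ≠ 0 := by omega
  set f := nfSeries r b c with hf
  have hf0 : constantCoeff f = 0 := constantCoeff_nfSeries hr0 b c
  obtain ⟨H, hH, h0, hw⟩ := (isEquivariantScaling_of_mem_stateGroup hφ).exists_scale
  set t := coeff (expo 1 0 0) H with ht
  have hg0 : constantCoeff (t • f) = 0 := by rw [smul_eq_C_mul, map_mul, hf0, mul_zero]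
  have hgr : rot F (t • f) = 0 := by rw [Derivation.map_smul, rot_nfSeries, smul_zero]
  obtain ⟨ψ, hψs, hψ⟩ := exists_mem_stateGroup_isExp hgr hg0
  refine ⟨t, ?_⟩
  have hψ' := hψ
  rw [smul_assoc] at hψ'
  have hθs : ψ⁻¹ * φ ∈ stateGroup F := mul_mem (inv_mem hψs) hφ
  set θ := ψ⁻¹ * φ with hθ
  have hθE : transport θ (f • euler F) = f • euler F := by
    have h1 : (SemidirectProduct.inr θ : OrbitalTransformation F) • f • euler F =
        f • euler F := by
      rw [hθ, map_mul, map_inv, mul_smul, inv_smul_eq_iff, inr_smul, inr_smul, h,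
        transport_eq_of_isExp_smul hf0 hψ']
    rwa [inr_smul] at h1
  have hθsc := isEquivariantScaling_of_mem_stateGroup hθs
  obtain ⟨H', hH', h0', hw'⟩ := hθsc.exists_scale
  have hH'r : rot F H' = 0 := by
    refine rot_eq_zero_of_mul rot_X_zero (X_ne_zero' 0) ?_
    rw [mul_comm, ← h0', ← hθsc.1, rot_X_zero, map_zero]
  have hφθ : φ = ψ * θ := by rw [hθ, mul_inv_cancel_left]
  have hR := raisesOrder_one_smul_euler hg0
  have hR0 : RaisesOrder (0 : Module.End F (PS F)) 1 := fun N q _ => zero_mem _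
  have hcoef : coeff (expo 1 0 0) (H' - 1) = 0 := by
    set K := expFactor (t • f) (t • f) with hK
    have hψ0 : ψ (X 0) = K * X 0 := hψ.apply_X_zero hg0
    have e1 : H = ψ H' * K := by
      refine mul_right_cancel₀ (X_ne_zero' 0) ?_
      rw [← h0, hφθ, AlgEquiv.mul_apply, h0', map_mul, hψ0, mul_assoc]
    have hKc : coeff (expo 1 0 0) K = t := by
      have h1 := expOp_sub_expOp_sub_mem hR hR0 (m := 1) (by rwa [sub_zero])
        (X_mem_orderIdeal 0) (expo 2 0 0) (by simp)
      rw [expOp_zero_apply, LinearMap.zero_apply, sub_zero, ← isExp_iff.1 hψ, hψ0] at h1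
      change coeff _ (K * X 0 - X 0 - t • f * euler F (X 0)) = 0 at h1
      rw [euler_X_zero, show K * X 0 - X 0 - t • f * X 0 = X 0 * (K - 1 - t • f) by ring,
        coeff_expo_succ_X_zero_mul, map_sub, map_sub, coeff_smul, hf, nfSeries_eq_X_add_radial,
        map_add, coeff_expo_X_zero, coeff_expo_radial_one] at h1
      have h2 : coeff (expo 1 0 0) (1 : PS F) = 0 := by
        simpa using coeff_expo_radial_one (1 : PowerSeries F)
      rw [h2] at h1
      linear_combination h1
    have hη : H' - 1 ∈ orderIdeal F 3 1 :=
      mem_orderIdeal_one.2 (by rw [map_sub, hH', constantCoeff_one, sub_self])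
    have hψη := expOp_sub_self_mem hR hη
    rw [← isExp_iff.1 hψ] at hψη
    have hK1 : K - 1 ∈ orderIdeal F 3 1 :=
      mem_orderIdeal_one.2 (by
        rw [map_sub, constantCoeff_expFactor hg0 hg0, constantCoeff_one, sub_self])
    have h5 := mul_mem_orderIdeal (algEquiv_mem_orderIdeal ψ hη) hK1
    -- From H = ψ(H') K: up to terms of order two, H' - 1 equals H - K, and both H and K have
    -- x-coefficient t.
    have e2 : H' - 1 = H - K - (ψ (H' - 1) - (H' - 1)) - ψ (H' - 1) * (K - 1) := by
      rw [map_sub, map_one, e1]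
      ring
    rw [e2, map_sub, map_sub, map_sub, hψη _ (by simp), h5 _ (by simp), hKc, ← ht]
    ring
  have h6 := eq_one_of_symmetryEquation hr hc hH'r hH'
    (symmetryEquation_of_transport h0' hw' hr0 hθE) hcoef
  have h7 : θ = 1 := hθsc.eq_one (by rw [h0', h6, one_mul])
  rw [hφθ, h7, mul_one]
  exact hψ'

end Symmetries

end

end HopfZero

/-! ### The theorem. -/

theorem mainTheorem2 (F : Type*) [Field F] [CharZero F] :
    (∃ σ : HopfZero.NormalFormStyle F, ∀ v : HopfZero.VF F,
      v - HopfZero.rot F ∈ HopfZero.eulerSpace F → HopfZero.HasNonzeroQuadraticPart v →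
        ∃ (r : ℕ) (b c : F), 2 ≤ r ∧
          HopfZero.OrbitallyEquivalent v (HopfZero.orbitalNF r b c) ∧
          HopfZero.IsInfiniteLevel σ (HopfZero.orbitalNF r b c) ∧
          ∀ (r' : ℕ) (b' c' : F), 2 ≤ r' →
            HopfZero.OrbitallyEquivalent v (HopfZero.orbitalNF r' b' c') →
            HopfZero.orbitalNF r' b' c' = HopfZero.orbitalNF r b c) ∧
    ∀ (r : ℕ) (b c : F), 2 ≤ r →
      ¬ Group.FG (HopfZero.symmetryGroup (HopfZero.orbitalNF r b c)) ∧
      ¬ Module.Finite F (HopfZero.coNormalSpace (HopfZero.orbitalNF r b c)) ∧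
      (c ≠ 0 → ∀ φ ∈ HopfZero.stateGroup F,
        (SemidirectProduct.inr φ ∈ HopfZero.symmetryGroup (HopfZero.orbitalNF r b c) ↔
          ∃ t : F, HopfZero.IsExp (t • (HopfZero.orbitalNF r b c - HopfZero.rot F)) φ)) := by
  open HopfZero in
  refine ⟨⟨radialStyle F, fun v hv hq => ?_⟩, fun r b c hr =>
    ⟨not_fg_symmetryGroup (by omega) b c, not_finite_coNormalSpace (by omega) b c,
      fun hc φ hφ => ?_⟩⟩
  · obtain ⟨r, b, c, hr, h⟩ := exists_orbitallyEquivalent_orbitalNF hv hq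
    exact ⟨r, b, c, hr, h, isInfiniteLevel_orbitalNF hr b c,
      fun r' b' c' hr' h' => orbitalNF_unique hr hr' h h'⟩
  · have hr0 : r ≠ 0 := by omega
    -- Permissibility is automatic for φ in `stateGroup`, so being a symmetry means exactly that φ
    -- preserves f E.
    have hmem : SemidirectProduct.inr φ ∈ symmetryGroup (orbitalNF r b c) ↔
        transport φ (nfSeries r b c • euler F) = nfSeries r b c • euler F := by
      rw [← inr_smul, ← orbitalNF_sub_rot]
      exact and_iff_right (inr_mem_permissibleGroup hφ)
    rw [hmem, orbitalNF_sub_rot]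
    exact ⟨exists_isExp_of_transport hr hc hφ, fun ⟨t, ht⟩ =>
      transport_eq_of_isExp_smul (constantCoeff_nfSeries hr0 b c) ht⟩
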